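/- Let $\mathcal E_1,\mathcal E_2$ be real Hilbert spaces and $\mathcal E=\mathcal E_1\times\mathcal E_2$ their product. Write $\sigma_S(\mu)=\sup_{x\in S}\langle\mu,x\rangle$, let $\iota_S$ be $0$ on $S$ and $+\infty$ elsewhere, let $\overline{\mathrm{co}}$ denote the closed convex hull, $f^*$ the Fenchel conjugate and $S^\ominus=\{x:\langle\mu,x\rangle\le0\ \forall\mu\in S\}$. Consider $\min_{x_1\in\mathcal E_1} f(x_1)+\sigma_Q(Ax_1-b)+\iota_K(x_1)$, with value $V$, and assume: $f:\mathcal E_1\to\mathbb R$ is convex and differentiable with $\beta$-Lipschitz gradient, $\beta>0$; $Q=Q_1+Q_2\subset\mathcal E_2$ is nonempty, $Q_1$ is a bounded closed convex set and $Q_2$ a closed convex cone; $K\subset\mathcal E_1$ is nonempty, closed and convex; $A:\mathcal E_1\to\mathcal E_2$ is bounded and linear; $b\in\mathcal E_2$; $K^{-1}\subset K$ is compact and $-b\in\operatorname{int}\big(Q_2^\ominus-A\,\overline{\mathrm{co}}\,K^{-1}\big)$. A set is called simple if it is the union of $K^{-1}$ and a finite set. Put $E=-\{x\in\mathcal E: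 x_1\in K,\ x_2=Ax_1\}$ and $$P(x_1)=f(x_1)+\sigma_Q(Ax_1-b),\qquad D(\mu)=f^*(\mu_1)+\iota_Q(\mu_2)+\langle\mu_2,b\rangle+\sigma_E(\mu).$$ The Dualized Level-Set method takes $\lambda\in(0,1)$, $\mu^0\in\mathcal E$ with $\mu^0_2\in Q$ and $\sigma_{-K}(\mu_1^0+A^*\mu_2^0)<+\infty$, and $w_1^0\in\partial f^*(\mu_1^0)$. It sets $\bar h^{-1}=\bar\Delta=+\infty$, $\hat\mu^{-1}=\mu^0$, and for $t=0,1,2,\dots$ it performs the following steps. 1. Oracle: choose $v_1^t\in-\operatorname{argmin}_{v\in K}\langle\mu_1^t+A^*\mu_2^t,v\rangle$; put $\tilde K^t=\overline{\mathrm{co}}(K^{t-1}\cup\{-v_1^t\})$. 2. Dual update: $\bar h^t=\min\{\bar h^{t-1},\ \langle\mu_2^t,b\rangle+\langle\mu_1^t,w_1^t\rangle+\langle\mu_1^t+A^*\mu_2^t,v_1^t\rangle-f(w_1^t)\}$; $\hat\mu^t=\mu^t$ if $\bar h^t<\bar h^{t-1}$, otherwise $\hat\mu^t=\hat\mu^{t-1}$.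 3. Primal update: $\hat x_1^t\in\operatorname{argmin}_{\tilde K^t}P$, $\underline h^t=-P(\hat x_1^t)$, $\Delta^t=\bar h^t-\underline h^t$, $\ell^t=\lambda\bar h^t+(1-\lambda)\underline h^t$. 4. Pruning: if $\Delta^t<(1-\lambda)\bar\Delta$, choose a simple $K^t\subset\tilde K^t$ with $\hat x_1^t\in\overline{\mathrm{co}}\,K^t$ and reset $\bar\Delta=\Delta^t$; otherwise $K^t=K^{t-1}\cup\{-v_1^t\}$. 5. Dual candidate: choose a minimizer $m^t$, over all nonpositive finite Borel measures $m$ on $K^t$, of $$(1-m(K^t))\,f\Big(\frac{w_1^t-\mathfrak Em}{1-m(K^t)}\Big)+\tfrac12\big(\|\tilde\mu_2\|^2-\operatorname{dist}(\tilde\mu_2,Q)^2\big)-\ell^t m(K^t),$$ where $\mathfrak Em=\int v\,dm(v)$ and $\tilde\mu_2=\mu_2^t+m(K^t)b-A\mathfrak Em$. Then $w_1^{t+1}=\frac{w_1^t-\mathfrak Em^t}{1-m^t(K^t)}$, $\mu_1^{t+1}=\nabla f(w_1^{t+1})$ and $\mu_2^{t+1}=\operatorname{proj}_Q\big(\mu_2^t+m^t(K^t)b-A\mathfrak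 Em^t\big)$. Consider an execution for which $(v_1^t)_{t\in\mathbb N}$ is bounded. Then $\Delta^t$ is the primal-dual gap, $\Delta^t=P(\hat x_1^t)+\iota_K(\hat x_1^t)+D(\hat\mu^t)$ for all $t$. For every $t$, exactly one solution $\hat x^t\in\mathcal E$ of the problem of minimizing $f(x_1)+\sigma_Q(x_2-b)$ over $\overline{\mathrm{co}}\big(\{x:x_1\in K^{t-1},x_2=Ax_1\}\cup\{-(v_1^t,Av_1^t)\}\big)$ has first component $\hat x_1^t$, and it satisfies $\hat x_2^t=A\hat x_1^t$. Moreover there is a constant $C>0$ such that, for all $t\ge1$, $$0\le\Delta^t\le\frac C{\sqrt t},\qquad 0\le f(\hat x_1^t)+\sigma_Q(A\hat x_1^t-b)-V\le\frac C{\sqrt t},$$ $$0\le f^*(\hat\mu_1^t)+\iota_Q(\hat\mu_2^t)+\langle\hat\mu_2^t,b\rangle+\sigma_E(\hat\mu^t)+V\le\frac C{\sqrt t}.$$ -/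

import Mathlib

open Set MeasureTheory
open scoped Pointwise InnerProductSpace NNReal Topology

noncomputable section

namespace DLS

/-! ### Convex analysis with values in the extended reals -/

section Convex

variable {H : Type*} [NormedAddCommGroup H] [InnerProductSpace ℝ H]

/-- The characteristic function `ι_S` of a set: `0` on `S`, `+∞` elsewhere. -/
def indic {α : Type*} (S : Set α) (x : α) : EReal :=
  open Classical in if x ∈ S then 0 else ⊤

/-- The support function `σ_S(μ) = sup_{x ∈ S} ⟨μ, x⟩`. -/
def supp (S : Set H) (μ : H) : EReal :=
  ⨆ x ∈ S, ((⟪μ, x⟫_ℝ : ℝ) : EReal)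

/-- The Legendre-Fenchel conjugate `f^*(μ) = sup_x ⟨μ, x⟩ - f(x)` of a real-valued function. -/
def conj (f : H → ℝ) (μ : H) : EReal :=
  ⨆ x : H, ((⟪μ, x⟫_ℝ - f x : ℝ) : EReal)

/-- The subdifferential of a function with values in the extended reals. -/
def subdiff (g : H → EReal) (μ : H) : Set H :=
  {w | ∀ ν : H, g μ + ((⟪w, ν - μ⟫_ℝ : ℝ) : EReal) ≤ g ν}

/-- The closed convex hull. -/
def cconv (S : Set H) : Set H := closure (convexHull ℝ S)

/-- The polar cone `S^⊖ = {x | ∀ μ ∈ S, ⟨μ, x⟩ ≤ 0}`. -/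
def polar (S : Set H) : Set H := {x | ∀ μ ∈ S, ⟪μ, x⟫_ℝ ≤ 0}

/-- The perspective function of a real-valued function `f`:
`s f(x / s)` if `s > 0`, `sup_y f(y + x) - f(y)` if `s = 0`, and `+∞` if `s < 0`. -/
def persp (f : H → ℝ) (x : H) (s : ℝ) : EReal :=
  if 0 < s then ((s * f (s⁻¹ • x) : ℝ) : EReal)
  else if s = 0 then ⨆ y : H, ((f (y + x) - f y : ℝ) : EReal)
  else ⊤

end Convex

/-- `x` is a solution to the problem of minimizing `g` over `S`. -/
def IsSolution {α β : Type*} [Preorder β] (g : α → β) (S : Set α) (x : α) : Prop :=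
  x ∈ S ∧ ∀ y ∈ S, g x ≤ g y

section Problem

variable {E₁ E₂ : Type*}
  [NormedAddCommGroup E₁] [InnerProductSpace ℝ E₁]
  [NormedAddCommGroup E₂] [InnerProductSpace ℝ E₂]

/-- The cost `f(x₁) + σ_Q(A x₁ - b)`. -/
def cost (f : E₁ → ℝ) (A : E₁ →L[ℝ] E₂) (b : E₂) (Q : Set E₂) (x₁ : E₁) : EReal :=
  (f x₁ : EReal) + supp Q (A x₁ - b)

/-- The value `V` of the primal problem: minimize `f(x₁) + σ_Q(A x₁ - b) + ι_K(x₁)`. -/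
def value (f : E₁ → ℝ) (A : E₁ →L[ℝ] E₂) (b : E₂) (Q : Set E₂) (K : Set E₁) : EReal :=
  ⨅ x₁ : E₁, cost f A b Q x₁ + indic K x₁

/-- The cost `f(x₁) + σ_Q(x₂ - b)` on the product space. -/
def liftedCost (f : E₁ → ℝ) (b : E₂) (Q : Set E₂) (x : WithLp 2 (E₁ × E₂)) : EReal :=
  (f x.fst : EReal) + supp Q (x.snd - b)

/-- The set `{x | x₁ ∈ S, x₂ = A x₁}` in the product Hilbert space. -/
def graphOver (A : E₁ →L[ℝ] E₂) (S : Set E₁) : Set (WithLp 2 (E₁ × E₂)) :=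
  {x | x.fst ∈ S ∧ x.snd = A x.fst}

/-- The dual cost `f^*(μ₁) + ι_Q(μ₂) + ⟨μ₂, b⟩ + σ_E(μ)`, where
`E = -{x | x₁ ∈ K, x₂ = A x₁}`. -/
def dualCost (f : E₁ → ℝ) (A : E₁ →L[ℝ] E₂) (b : E₂) (Q : Set E₂) (K : Set E₁)
    (μ : WithLp 2 (E₁ × E₂)) : EReal :=
  conj f μ.fst + indic Q μ.snd + ((⟪μ.snd, b⟫_ℝ : ℝ) : EReal) + supp (-graphOver A K) μ

/-- The sets of the form `K⁻¹ ∪ S` with `S` finite. -/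
def IsSimpleSet (Kinit K' : Set E₁) : Prop :=
  ∃ S : Set E₁, S.Finite ∧ K' = Kinit ∪ S

/-! ### The projection subproblem

An element `m` of `-M₊(S)` is encoded by the nonnegative finite Borel measure `n = -m`. It is seen
as a measure on `E₁` that vanishes outside `S`. Thus `m(S) = -(mass n)` and the vector `𝔈 m`,
characterized by `⟨μ, 𝔈 m⟩ = ∫_S ⟨μ, v⟩ dm(v)` for all `μ`, is `-(mean n)`. -/

section Measure

variable [MeasurableSpace E₁]

/-- The nonnegative finite measures on `S`. -/
def posMeasures (S : Set E₁) : Set (Measure E₁) := {n | IsFiniteMeasure n ∧ n Sᶜ = 0}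

/-- The total mass of a finite measure. -/
def mass (n : Measure E₁) : ℝ := n.real univ

/-- The vector `∫ v dn(v)`. -/
def mean (n : Measure E₁) : E₁ := ∫ v, v ∂n

/-- The vector `μ̃₂ = -A 𝔈 m + m(S) b + μ₂`, for `m = -n`. -/
def shifted (A : E₁ →L[ℝ] E₂) (b : E₂) (μ₂ : E₂) (n : Measure E₁) : E₂ :=
  A (mean n) - mass n • b + μ₂

/-- The cost of the projection subproblem,
`f̃(-𝔈 m + w, 1 - m(S)) + (‖μ̃₂‖² - dist(μ̃₂, Q)²) / 2 - ℓ m(S)`, for `m = -n`. -/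
def projCost (f : E₁ → ℝ) (A : E₁ →L[ℝ] E₂) (b : E₂) (Q : Set E₂)
    (w : E₁) (μ₂ : E₂) (ℓ : EReal) (n : Measure E₁) : EReal :=
  persp f (mean n + w) (1 + mass n)
    + (((‖shifted A b μ₂ n‖ ^ 2 - Metric.infDist (shifted A b μ₂ n) Q ^ 2) / 2 : ℝ) : EReal)
    + ℓ * ((mass n : ℝ) : EReal)

end Measure

/-! ### The Dualized Level-Set method -/

/-- The quantities produced along the iterations `t = 0, 1, 2, …`. A field whose name ends in
`Before` holds the value available at the *beginning* of iteration `t`, i.e. the one that carries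
the superscript `t - 1`. -/
structure Trace (E₁ E₂ : Type*) [MeasurableSpace E₁] where
  /-- the dual candidate `μ^t` -/
  μ : ℕ → WithLp 2 (E₁ × E₂)
  /-- the vector `w₁^t` -/
  w : ℕ → E₁
  /-- the output `v₁^t` of the oracle -/
  v : ℕ → E₁
  /-- `h̄^{t-1}` -/
  hbarBefore : ℕ → EReal
  /-- `μ̂^{t-1}` -/
  μhatBefore : ℕ → WithLp 2 (E₁ × E₂)
  /-- the primal iterate `x̂₁^t` -/
  xhat : ℕ → E₁
  /-- the value of `Δ̄` at the beginning of iteration `t` -/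
  ΔbarBefore : ℕ → EReal
  /-- `K^{t-1}` -/
  KBefore : ℕ → Set E₁
  /-- the measure `-m^t` -/
  n : ℕ → Measure E₁

namespace Trace

variable [MeasurableSpace E₁]

/-- `h̄^t` -/
def hbar (T : Trace E₁ E₂) (t : ℕ) : EReal := T.hbarBefore (t + 1)

/-- `μ̂^t` -/
def μhat (T : Trace E₁ E₂) (t : ℕ) : WithLp 2 (E₁ × E₂) := T.μhatBefore (t + 1)

/-- `K^t` -/
def Kcut (T : Trace E₁ E₂) (t : ℕ) : Set E₁ := T.KBefore (t + 1)

/-- `K̃^t`, the closed convex hull of `K^{t-1} ∪ {-v₁^t}` -/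
def Ktilde (T : Trace E₁ E₂) (t : ℕ) : Set E₁ := cconv (T.KBefore t ∪ {-T.v t})

/-- `Ẽ^t`, the closed convex hull of `E^{t-1} ∪ {v^t}`, where
`E^{t-1} = {x | x₁ ∈ -K^{t-1}, x₂ = A x₁}` and `v^t = (v₁^t, A v₁^t)` -/
def Etilde (T : Trace E₁ E₂) (A : E₁ →L[ℝ] E₂) (t : ℕ) : Set (WithLp 2 (E₁ × E₂)) :=
  cconv (graphOver A (-T.KBefore t) ∪ {WithLp.toLp 2 (T.v t, A (T.v t))})

/-- the lower bound `-f(x̂₁^t) - σ_Q(A x̂₁^t - b)` -/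
def hunder (T : Trace E₁ E₂) (f : E₁ → ℝ) (A : E₁ →L[ℝ] E₂) (b : E₂) (Q : Set E₂) (t : ℕ) :
    EReal :=
  -cost f A b Q (T.xhat t)

/-- the gap `Δ^t` -/
def Δ (T : Trace E₁ E₂) (f : E₁ → ℝ) (A : E₁ →L[ℝ] E₂) (b : E₂) (Q : Set E₂) (t : ℕ) : EReal :=
  T.hbar t - T.hunder f A b Q t

/-- the level `ℓ^t` -/
def level (T : Trace E₁ E₂) (f : E₁ → ℝ) (A : E₁ →L[ℝ] E₂) (b : E₂) (Q : Set E₂) (lam : ℝ)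
    (t : ℕ) : EReal :=
  (lam : EReal) * T.hbar t + ((1 - lam : ℝ) : EReal) * T.hunder f A b Q t

end Trace

/-- `T` is an execution of the Dualized Level-Set method with parameter `lam`. -/
structure IsRun [MeasurableSpace E₁] [CompleteSpace E₁] [CompleteSpace E₂]
    (f : E₁ → ℝ) (A : E₁ →L[ℝ] E₂) (b : E₂) (Q : Set E₂)
    (K Kinit : Set E₁) (lam : ℝ) (T : Trace E₁ E₂) : Prop where
  -- Requirements and initialization (`w₁⁰ ∈ ∂f^*(μ₁⁰)` contains `μ₁⁰ ∈ dom ∂f^*`)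
  init_w : T.w 0 ∈ subdiff (conj f) (T.μ 0).fst
  init_μ₂ : (T.μ 0).snd ∈ Q
  init_dom : ∃ r : ℝ, supp (-K) ((T.μ 0).fst + A.adjoint (T.μ 0).snd) = (r : EReal)
  init_hbar : T.hbarBefore 0 = ⊤
  init_μhat : T.μhatBefore 0 = T.μ 0
  init_Δbar : T.ΔbarBefore 0 = ⊤
  init_K : T.KBefore 0 = Kinit
  -- Oracle
  oracle : ∀ t, IsSolution (fun v₁ => ⟪(T.μ t).fst + A.adjoint (T.μ t).snd, v₁⟫_ℝ) K (-T.v t)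
  -- Dual update
  hbar_eq : ∀ t, T.hbar t = min (T.hbarBefore t)
    ((⟪(T.μ t).snd, b⟫_ℝ + ⟪(T.μ t).fst, T.w t⟫_ℝ
      + ⟪(T.μ t).fst + A.adjoint (T.μ t).snd, T.v t⟫_ℝ - f (T.w t) : ℝ) : EReal)
  μhat_new : ∀ t, T.hbar t < T.hbarBefore t → T.μhat t = T.μ t
  μhat_old : ∀ t, ¬ T.hbar t < T.hbarBefore t → T.μhat t = T.μhatBefore t
  -- Primal update
  xhat_sol : ∀ t, IsSolution (cost f A b Q) (T.Ktilde t) (T.xhat t)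
  -- Pruning
  prune : ∀ t, T.Δ f A b Q t < ((1 - lam : ℝ) : EReal) * T.ΔbarBefore t →
    T.Kcut t ⊆ T.Ktilde t ∧ IsSimpleSet Kinit (T.Kcut t) ∧ T.xhat t ∈ cconv (T.Kcut t) ∧
      T.ΔbarBefore (t + 1) = T.Δ f A b Q t
  no_prune : ∀ t, ¬ T.Δ f A b Q t < ((1 - lam : ℝ) : EReal) * T.ΔbarBefore t →
    T.Kcut t = T.KBefore t ∪ {-T.v t} ∧ T.ΔbarBefore (t + 1) = T.ΔbarBefore t
  -- Dual candidate
  n_sol : ∀ t, IsSolution (projCost f A b Q (T.w t) (T.μ t).snd (T.level f A b Q lam t))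
    (posMeasures (T.Kcut t)) (T.n t)
  w_next : ∀ t, T.w (t + 1) = (1 + mass (T.n t))⁻¹ • (T.w t + mean (T.n t))
  μ₁_next : ∀ t, (T.μ (t + 1)).fst = gradient f (T.w (t + 1))
  μ₂_next : ∀ t, IsSolution (fun q => ‖shifted A b (T.μ t).snd (T.n t) - q‖) Q (T.μ (t + 1)).snd

end Problem

end DLS

end

/-! Minimizing over the measures `m` is the Lagrangian dual of a Bregman projection: `(μ₁, μ₂)` is
projected, in the divergence of `f^*` plus half a squared norm, onto the points with `μ₂ ∈ Q` whose
cuts indexed by `K^t` lie below the level `ℓ^t`. The one-sided optimality conditions show that the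
new point obeys these cuts (`cut_le_level`). They also give a three-point inequality
(`diverg_add_diverg_le`): up to a slack, the divergence to any comparison point obeying the cuts
drops by at least the divergence of the move.

Between two prunings the cuts accumulate, and the gap stays within a factor `1 - λ` of the reference
gap. This keeps every level of the phase above the final lower bound `-P(x̂₁)`, so one approximate
dual solution of the last primal subproblem serves as comparison point for the whole phase. Such
points come from a minimax argument (`exists_cut_le_of_forall_exists_lt`), and the qualification
condition bounds them (`exists_norm_le_of_cut_le`). Hence the divergences of the moves have a
bounded sum. Conversely, each move brings the newest cut from at least `h̄` down to at most `h̄ - (1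
- λ)Δ`, which costs a divergence of order `Δ²` (`gap_sq_le_diverg`).

A phase with reference gap `r` thus has `O(1/r²)` iterations (`exists_phase_bound`). Reference gaps
decrease geometrically, so summing over phases gives `Δ^t = O(1/√t)` (`exists_mul_gap_sq_le`). By
weak duality `V` lies between `-h̄` and `P(x̂₁)`, so the gap bounds both errors. -/

noncomputable section

namespace DLS

/-! ### Smooth convex functions -/

section Smooth

variable {H : Type*} [NormedAddCommGroup H] [InnerProductSpace ℝ H] [CompleteSpace H]

/-- A convex differentiable function with `β`-Lipschitz gradient. -/
structure IsSmoothConvex (f : H → ℝ) (β : ℝ≥0) : Prop where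
  convex : ConvexOn ℝ univ f
  diff : Differentiable ℝ f
  lip : LipschitzWith β (gradient f)

/-- The Bregman divergence of `f`. -/
def bregman (f : H → ℝ) (w y : H) : ℝ := f w - f y - ⟪gradient f y, w - y⟫_ℝ

variable {f : H → ℝ} {β : ℝ≥0}

theorem IsSmoothConvex.gradient_le (hf : IsSmoothConvex f β) (x y : H) :
    f x + ⟪gradient f x, y - x⟫_ℝ ≤ f y := by
  have hc : ConvexOn ℝ univ (f ∘ (AffineMap.lineMap x y : ℝ →ᵃ[ℝ] H)) := by
    simpa using hf.convex.comp_affineMap (AffineMap.lineMap x y : ℝ →ᵃ[ℝ] H)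
  have hd : HasDerivAt (f ∘ (AffineMap.lineMap x y : ℝ →ᵃ[ℝ] H)) ⟪gradient f x, y - x⟫_ℝ 0 := by
    have h1 : HasFDerivAt f (InnerProductSpace.toDual ℝ H (gradient f x))
        ((AffineMap.lineMap x y : ℝ →ᵃ[ℝ] H) 0) := by
      simpa using (hf.diff x).hasGradientAt.hasFDerivAt
    have h2 : HasDerivAt (AffineMap.lineMap x y : ℝ →ᵃ[ℝ] H) (y - x) 0 :=
      AffineMap.hasDerivAt_lineMap
    simpa using h1.comp_hasDerivAt (0 : ℝ) h2
  have := hc.le_slope_of_hasDerivAt (mem_univ 0) (mem_univ 1) one_pos hd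
  simp only [slope_def_field, Function.comp_apply, AffineMap.lineMap_apply_one,
    AffineMap.lineMap_apply_zero, sub_zero, div_one] at this
  linarith

/-- Convexity at `y` and Cauchy-Schwarz suffice; the constant `β` instead of `β / 2` spares an
integration along the segment and only affects constants in the rate. -/
theorem IsSmoothConvex.descent (hf : IsSmoothConvex f β) (x y : H) :
    f y ≤ f x + ⟪gradient f x, y - x⟫_ℝ + β * ‖y - x‖ ^ 2 := by
  have h1 := hf.gradient_le y x
  have h2 : ⟪gradient f y - gradient f x, y - x⟫_ℝ ≤ β * ‖y - x‖ ^ 2 := by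
    refine (real_inner_le_norm _ _).trans ?_
    have := hf.lip.norm_sub_le y x
    nlinarith [norm_nonneg (y - x)]
  rw [inner_sub_left] at h2
  have h3 : ⟪gradient f y, x - y⟫_ℝ = -⟪gradient f y, y - x⟫_ℝ := by
    rw [← inner_neg_right, neg_sub]
  linarith

theorem IsSmoothConvex.bregman_nonneg (hf : IsSmoothConvex f β) (w y : H) :
    0 ≤ bregman f w y := by
  have := hf.gradient_le y w
  unfold bregman; linarith

theorem IsSmoothConvex.bregman_le (hf : IsSmoothConvex f β) (w y : H) :
    bregman f w y ≤ β * ‖w - y‖ ^ 2 := by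
  have := hf.descent y w
  unfold bregman; linarith

theorem IsSmoothConvex.norm_gradient_sub_sq_le (hf : IsSmoothConvex f β) (hβ : 0 < β) (w y : H) :
    ‖gradient f w - gradient f y‖ ^ 2 ≤ 4 * β * bregman f w y := by
  have hβ' : (0 : ℝ) < β := hβ
  set d := gradient f w - gradient f y with hd
  -- This step length maximizes `c - β c²`, the decrease guaranteed by `descent`.
  set c : ℝ := (2 * (β : ℝ))⁻¹ with hc
  have h1 := hf.gradient_le y (w - c • d)
  have h2 := hf.descent w (w - c • d)
  have e1 : w - c • d - w = -(c • d) := by abel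
  have e2 : w - c • d - y = (w - y) - c • d := by abel
  have e3 : ⟪gradient f w, d⟫_ℝ - ⟪gradient f y, d⟫_ℝ = ‖d‖ ^ 2 := by
    rw [← inner_sub_left, real_inner_self_eq_norm_sq]
  rw [e1, inner_neg_right, inner_smul_right, norm_neg, norm_smul, mul_pow, Real.norm_eq_abs,
    sq_abs] at h2
  rw [e2, inner_sub_right, inner_smul_right] at h1
  have h3 : c * ‖d‖ ^ 2 - β * (c ^ 2 * ‖d‖ ^ 2) ≤ bregman f w y := by
    unfold bregman
    rw [← e3]
    rw [← e3] at h2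
    linarith
  have h4 : c * ‖d‖ ^ 2 - β * (c ^ 2 * ‖d‖ ^ 2) = ‖d‖ ^ 2 / (4 * β) := by
    rw [hc]; field_simp; ring
  rw [h4, div_le_iff₀ (by positivity)] at h3
  linarith

theorem IsSmoothConvex.conj_gradient (hf : IsSmoothConvex f β) (w : H) :
    conj f (gradient f w) = ((⟪gradient f w, w⟫_ℝ - f w : ℝ) : EReal) := by
  refine le_antisymm (iSup_le fun x => ?_) (le_iSup (fun x : H =>
    ((⟪gradient f w, x⟫_ℝ - f x : ℝ) : EReal)) w)
  have := hf.gradient_le w x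
  rw [inner_sub_right] at this
  exact EReal.coe_le_coe_iff.2 (by linarith)

/-- A first-order condition: a directional derivative is nonnegative at a minimum. -/
theorem nonneg_of_quadratic_bound {D M : ℝ}
    (h : ∀ ε : ℝ, 0 < ε → ε ≤ 1 → 0 ≤ ε * D + ε ^ 2 * M) : 0 ≤ D := by
  by_contra! hD
  have hM : 0 < |M| + 1 := by positivity
  have hε : 0 < min 1 (-D / (2 * (|M| + 1))) := lt_min one_pos (by apply div_pos <;> linarith)
  set ε := min 1 (-D / (2 * (|M| + 1))) with hεd
  have h1 := h ε hε (min_le_left _ _)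
  have h2 : ε * (2 * (|M| + 1)) ≤ -D := by
    rw [← le_div_iff₀ (by positivity)]; exact min_le_right _ _
  have h3 : 0 ≤ D + ε * M := by
    have : 0 ≤ ε * (D + ε * M) := by nlinarith
    exact nonneg_of_mul_nonneg_right this hε
  nlinarith [le_abs_self M]

/-- Testing the subgradient inequality at `∇f(w)`, where the conjugate is known, shows that `w`
maximizes `⟨μ, ·⟩ - f`. A small move along `μ - ∇f(w)` would then improve on `w` unless this vector
vanishes. -/
theorem IsSmoothConvex.eq_gradient_of_mem_subdiff_conj (hf : IsSmoothConvex f β) {μ w : H}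
    (hw : w ∈ subdiff (conj f) μ) : μ = gradient f w := by
  have h := hw (gradient f w)
  rw [hf.conj_gradient] at h
  have key : ∀ x : H, ⟪μ, x⟫_ℝ - f x ≤ ⟪μ, w⟫_ℝ - f w := by
    intro x
    have h1 : ((⟪μ, x⟫_ℝ - f x : ℝ) : EReal) ≤ conj f μ :=
      le_iSup (fun x : H => ((⟪μ, x⟫_ℝ - f x : ℝ) : EReal)) x
    have h2 := (add_le_add_left h1 (((⟪w, gradient f w - μ⟫_ℝ : ℝ) : EReal))).trans h
    rw [← EReal.coe_add, EReal.coe_le_coe_iff, inner_sub_right, real_inner_comm w,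
      real_inner_comm μ w] at h2
    linarith
  set d := gradient f w - μ with hd
  have h0 : 0 ≤ -‖d‖ ^ 2 := by
    refine nonneg_of_quadratic_bound (M := β * ‖d‖ ^ 2) fun ε hε _ => ?_
    have h1 := key (w - ε • d)
    have h2 := hf.descent w (w - ε • d)
    have e1 : w - ε • d - w = -(ε • d) := by abel
    have e3 : ⟪gradient f w, d⟫_ℝ - ⟪μ, d⟫_ℝ = ‖d‖ ^ 2 := by
      rw [← inner_sub_left, real_inner_self_eq_norm_sq]
    rw [e1, inner_neg_right, inner_smul_right, norm_neg, norm_smul, mul_pow, Real.norm_eq_abs,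
      sq_abs] at h2
    rw [inner_sub_right, inner_smul_right] at h1
    have : ε * ‖d‖ ^ 2 ≤ β * (ε ^ 2 * ‖d‖ ^ 2) := by
      rw [← e3] ; rw [← e3] at h2; linarith
    linarith
  have : ‖d‖ = 0 := by nlinarith [norm_nonneg d]
  rw [norm_eq_zero, hd, sub_eq_zero] at this
  exact this.symm

end Smooth

/-! ### Projections -/

section Projection

variable {H : Type*} [NormedAddCommGroup H] [InnerProductSpace ℝ H]

theorem IsSolution.inner_sub_le_zero {Q : Set H} (hQ : Convex ℝ Q) {z p : H}
    (hp : IsSolution (fun q => ‖z - q‖) Q p) : ∀ q ∈ Q, ⟪z - p, q - p⟫_ℝ ≤ 0 := by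
  rw [← norm_eq_iInf_iff_real_inner_le_zero hQ hp.1]
  have : Nonempty Q := ⟨⟨p, hp.1⟩⟩
  refine le_antisymm (le_ciInf fun q => hp.2 q q.2) ?_
  exact ciInf_le (f := fun q : Q => ‖z - q‖) ⟨0, by rintro _ ⟨q, rfl⟩; exact norm_nonneg _⟩
    ⟨p, hp.1⟩

/-- The function `(‖z‖² - dist(z, Q)²) / 2` is smooth, and its gradient is the projection. -/
theorem norm_sq_sub_infDist_sq_le {Q : Set H} (hQ : Convex ℝ Q) {z p : H}
    (hp : IsSolution (fun q => ‖z - q‖) Q p) (z' : H) :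
    (‖z'‖ ^ 2 - Metric.infDist z' Q ^ 2) / 2 ≤
      (‖z‖ ^ 2 - Metric.infDist z Q ^ 2) / 2 + ⟪p, z' - z⟫_ℝ + ‖z' - z‖ ^ 2 / 2 := by
  have hne : Q.Nonempty := ⟨p, hp.1⟩
  have hd : Metric.infDist z Q ≤ ‖z - p‖ := by
    simpa [dist_eq_norm] using Metric.infDist_le_dist_of_mem (x := z) hp.1
  have hd2 : Metric.infDist z Q ^ 2 ≤ ‖z - p‖ ^ 2 := by
    gcongr
    exact Metric.infDist_nonneg
  have key : ‖z'‖ ^ 2 - (‖z‖ ^ 2 - ‖z - p‖ ^ 2) - 2 * ⟪p, z' - z⟫_ℝ - ‖z' - z‖ ^ 2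
      ≤ Metric.infDist z' Q ^ 2 := by
    rw [← Real.sqrt_le_left Metric.infDist_nonneg, Metric.le_infDist hne]
    intro q hq
    rw [Real.sqrt_le_left dist_nonneg, dist_eq_norm]
    have h1 := hp.inner_sub_le_zero hQ q hq
    -- The claim is this square combined with the variational inequality for `p`.
    have h2 : 0 ≤ ‖(z' - z) - (q - p)‖ ^ 2 := by positivity
    simp only [← real_inner_self_eq_norm_sq, inner_sub_left, inner_sub_right] at h1 h2 ⊢
    have := real_inner_comm z z'
    have := real_inner_comm z p
    have := real_inner_comm z q
    have := real_inner_comm z' p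
    have := real_inner_comm z' q
    have := real_inner_comm p q
    linarith
  linarith

end Projection

/-! ### Finite measures on compact sets -/

section Measure

theorem mass_nonneg {α : Type*} [MeasurableSpace α] (n : Measure α) : 0 ≤ mass n :=
  measureReal_nonneg

theorem ae_mem_of_mem_posMeasures {α : Type*} [MeasurableSpace α] {S : Set α} {n : Measure α}
    (hn : n ∈ posMeasures S) : ∀ᵐ v ∂n, v ∈ S :=
  mem_ae_iff.2 hn.2

theorem integrable_id_of_mem_posMeasures {H : Type*} [NormedAddCommGroup H] [MeasurableSpace H]
    [BorelSpace H] {S : Set H} {n : Measure H} (hS : IsCompact S) (hn : n ∈ posMeasures S) :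
    Integrable (fun v : H => v) n := by
  have := hn.1
  obtain ⟨R, hR⟩ := hS.isBounded.exists_norm_le
  refine Integrable.of_bound (aestronglyMeasurable_iff_aemeasurable_separable.2
    ⟨aemeasurable_id, S, hS.isSeparable, ae_mem_of_mem_posMeasures hn⟩) R ?_
  filter_upwards [ae_mem_of_mem_posMeasures hn] with v hv using hR v hv

variable {H : Type*} [NormedAddCommGroup H] [InnerProductSpace ℝ H] [MeasurableSpace H]
  {S : Set H} {n : Measure H}

theorem exists_posMeasures_scale (hn : n ∈ posMeasures S) {ε : ℝ} (hε : ε ≤ 1) :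
    ∃ n' ∈ posMeasures S, mass n' = mass n + ε * -mass n ∧ mean n' = mean n + ε • -mean n := by
  have := hn.1
  have h0 : 0 ≤ 1 - ε := by linarith
  refine ⟨ENNReal.ofReal (1 - ε) • n, ⟨Measure.smul_finite _ ENNReal.ofReal_ne_top, ?_⟩, ?_, ?_⟩
  · simp [hn.2]
  · simp only [mass, measureReal_ennreal_smul_apply, ENNReal.toReal_ofReal h0]
    ring
  · rw [mean, integral_smul_measure, ENNReal.toReal_ofReal h0, mean]
    module

theorem norm_mean_le {R : ℝ} (hR : ∀ v ∈ S, ‖v‖ ≤ R) (hn : n ∈ posMeasures S) :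
    ‖mean n‖ ≤ R * mass n := by
  have := hn.1
  refine norm_integral_le_of_norm_le_const ?_
  filter_upwards [ae_mem_of_mem_posMeasures hn] with v hv using hR v hv

variable [BorelSpace H] [CompleteSpace H]

theorem mass_mul_le_inner_mean (hS : IsCompact S) (hn : n ∈ posMeasures S) {a : ℝ} {c : H}
    (h : ∀ v ∈ S, a ≤ ⟪c, v⟫_ℝ) : mass n * a ≤ ⟪c, mean n⟫_ℝ := by
  have := hn.1
  have hi := integrable_id_of_mem_posMeasures hS hn
  have h1 : ⟪c, mean n⟫_ℝ = ∫ v, ⟪c, v⟫_ℝ ∂n := (integral_inner hi c).symm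
  have h2 : mass n * a = ∫ _, a ∂n := by simp [mass]
  rw [h1, h2]
  refine integral_mono_ae (integrable_const _) (hi.const_inner c) ?_
  filter_upwards [ae_mem_of_mem_posMeasures hn] with v hv using h v hv

theorem exists_posMeasures_add_dirac (hS : IsCompact S) (hn : n ∈ posMeasures S) {k : H}
    (hk : k ∈ S) {ε : ℝ} (hε : 0 < ε) :
    ∃ n' ∈ posMeasures S, mass n' = mass n + ε * 1 ∧ mean n' = mean n + ε • k := by
  have := hn.1
  have hi := integrable_id_of_mem_posMeasures hS hn
  have hd : Measure.dirac k ∈ posMeasures S :=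
    ⟨inferInstance, by simp [hS.isClosed.measurableSet.compl, hk]⟩
  have hid := integrable_id_of_mem_posMeasures hS hd
  refine ⟨n + ENNReal.ofReal ε • Measure.dirac k, ⟨?_, ?_⟩, ?_, ?_⟩
  · have : IsFiniteMeasure (ENNReal.ofReal ε • Measure.dirac k) :=
      Measure.smul_finite _ ENNReal.ofReal_ne_top
    infer_instance
  · simp [hn.2, hd.2]
  · have : IsFiniteMeasure (ENNReal.ofReal ε • Measure.dirac k) :=
      Measure.smul_finite _ ENNReal.ofReal_ne_top
    simp [mass, measureReal_add_apply, measureReal_ennreal_smul_apply, hε.le]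
  · rw [mean, integral_add_measure hi (hid.smul_measure ENNReal.ofReal_ne_top),
      integral_smul_measure, integral_dirac, ENNReal.toReal_ofReal hε.le, mean]

end Measure

/-! ### The projection subproblem -/

section Projection

variable {E₁ E₂ : Type*}
  [NormedAddCommGroup E₁] [InnerProductSpace ℝ E₁] [MeasurableSpace E₁]
  [NormedAddCommGroup E₂] [InnerProductSpace ℝ E₂]
  {f : E₁ → ℝ} {β : ℝ≥0} {A : E₁ →L[ℝ] E₂} {b : E₂} {Q : Set E₂} {S : Set E₁} {n : Measure E₁}

theorem projCost_eq_coe (w : E₁) (μ₂ : E₂) (ℓ : ℝ) (n : Measure E₁) :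
    projCost f A b Q w μ₂ ℓ n = (((1 + mass n) * f ((1 + mass n)⁻¹ • (mean n + w))
      + (‖shifted A b μ₂ n‖ ^ 2 - Metric.infDist (shifted A b μ₂ n) Q ^ 2) / 2
      + ℓ * mass n : ℝ) : EReal) := by
  have : 0 < 1 + mass n := by
    have := mass_nonneg n
    linarith
  simp [projCost, persp, this]

variable [CompleteSpace E₁]

/-- The cut `f^*(μ₁) + ⟨μ₂, b⟩ - ⟨μ₁, k⟩ - ⟨μ₂, A k⟩` of the dual cost at `μ = (∇f(w), q)`. -/
def cut (f : E₁ → ℝ) (A : E₁ →L[ℝ] E₂) (b : E₂) (w : E₁) (q : E₂) (k : E₁) : ℝ :=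
  ⟪gradient f w, w⟫_ℝ - f w + ⟪q, b⟫_ℝ - ⟪gradient f w, k⟫_ℝ - ⟪q, A k⟫_ℝ

/-- The divergence of `(∇f(y), q')` from `(∇f(w), q)`. -/
def diverg (f : E₁ → ℝ) (w : E₁) (q : E₂) (y : E₁) (q' : E₂) : ℝ :=
  bregman f w y + ‖q' - q‖ ^ 2 / 2

/-- The one-sided derivatives of the cost of the projection subproblem are nonnegative at a
solution. -/
theorem projCost_first_order (hf : IsSmoothConvex f β) (hQ : Convex ℝ Q) {w w' : E₁} {μ₂ p : E₂}
    {ℓ : ℝ} (hn : IsSolution (projCost f A b Q w μ₂ ℓ) (posMeasures S) n)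
    (hw' : w' = (1 + mass n)⁻¹ • (w + mean n))
    (hp : IsSolution (fun q => ‖shifted A b μ₂ n - q‖) Q p) {σ : ℝ} {η : E₁}
    (hdir : ∀ ε : ℝ, 0 < ε → ε ≤ 1 →
      ∃ n' ∈ posMeasures S, mass n' = mass n + ε * σ ∧ mean n' = mean n + ε • η) :
    0 ≤ σ * (f w' - ⟪gradient f w', w'⟫_ℝ) + ⟪gradient f w', η⟫_ℝ + ⟪p, A η - σ • b⟫_ℝ
      + ℓ * σ := by
  refine nonneg_of_quadratic_bound
    (M := β * ‖η - σ • w'‖ ^ 2 + ‖A η - σ • b‖ ^ 2 / 2) fun ε hε hε1 => ?_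
  obtain ⟨n', hn', hm, he⟩ := hdir ε hε hε1
  have hmin := hn.2 n' hn'
  rw [projCost_eq_coe, projCost_eq_coe, EReal.coe_le_coe_iff] at hmin
  have hs : 0 ≤ mass n := mass_nonneg n
  have hs' : 0 ≤ mass n' := mass_nonneg n'
  have hsh : shifted A b μ₂ n' - shifted A b μ₂ n = ε • (A η - σ • b) := by
    simp only [shifted, hm, he, map_add, map_smul]
    module
  have h1 := norm_sq_sub_infDist_sq_le hQ hp (shifted A b μ₂ n')
  rw [hsh, inner_smul_right, norm_smul, mul_pow, Real.norm_eq_abs, sq_abs] at h1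
  set w'' := (1 + mass n')⁻¹ • (mean n' + w) with hw''
  have hS0 : (0 : ℝ) < 1 + mass n' := by linarith
  have e0 : (1 + mass n) • w' = w + mean n := by
    rw [hw', smul_smul, mul_inv_cancel₀ (by linarith), one_smul]
  have e1 : (1 + mass n') • (w'' - w') = ε • (η - σ • w') := by
    have e2 : (1 + mass n') • w'' = mean n' + w := by
      rw [hw'', smul_smul, mul_inv_cancel₀ hS0.ne', one_smul]
    rw [smul_sub, e2, he, hm]
    have : (1 + (mass n + ε * σ)) • w' = (w + mean n) + (ε * σ) • w' := by
      rw [← e0]; module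
    rw [this]; module
  have h2 := hf.descent w' w''
  have h3 : (1 + mass n') * ⟪gradient f w', w'' - w'⟫_ℝ
      = ε * ⟪gradient f w', η - σ • w'⟫_ℝ := by
    rw [← inner_smul_right, e1, inner_smul_right]
  have h4 : (1 + mass n') * ‖w'' - w'‖ ^ 2 ≤ ε ^ 2 * ‖η - σ • w'‖ ^ 2 := by
    have : ‖(1 + mass n') • (w'' - w')‖ ^ 2 = ‖ε • (η - σ • w')‖ ^ 2 := by rw [e1]
    rw [norm_smul, norm_smul, mul_pow, mul_pow, Real.norm_eq_abs, Real.norm_eq_abs, sq_abs,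
      sq_abs] at this
    rw [← this]
    -- The mass is nonnegative, so `1 + mass n'` is at most its own square.
    exact mul_le_mul_of_nonneg_right (by nlinarith) (by positivity)
  have h5 : (1 + mass n') * f w'' ≤ (1 + mass n') * f w' + ε * ⟪gradient f w', η - σ • w'⟫_ℝ
      + β * (ε ^ 2 * ‖η - σ • w'‖ ^ 2) := by
    have := mul_le_mul_of_nonneg_left h2 hS0.le
    have := mul_le_mul_of_nonneg_left h4 β.coe_nonneg
    linarith
  rw [add_comm (mean n) w, ← hw', hm] at hmin
  rw [inner_sub_right, inner_smul_right, hm] at h5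
  linarith

variable [BorelSpace E₁]

/-- Adding a small Dirac mass at `k` is a feasible direction, and its derivative is the slack of the
cut at `k`. -/
theorem cut_le_level (hf : IsSmoothConvex f β) (hQ : Convex ℝ Q) (hS : IsCompact S) {w w' : E₁}
    {μ₂ p : E₂} {ℓ : ℝ} (hn : IsSolution (projCost f A b Q w μ₂ ℓ) (posMeasures S) n)
    (hw' : w' = (1 + mass n)⁻¹ • (w + mean n))
    (hp : IsSolution (fun q => ‖shifted A b μ₂ n - q‖) Q p) {k : E₁} (hk : k ∈ S) :
    cut f A b w' p k ≤ ℓ := by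
  have := projCost_first_order hf hQ hn hw' hp
    fun ε hε _ => exists_posMeasures_add_dirac hS hn.1 hk hε
  rw [one_smul, inner_sub_right] at this
  unfold cut; linarith

/-- Four inequalities add up to the claim: shrinking the measure gives one half of complementary
slackness, the cuts at `(y, q)` are integrated against `n`, `p` satisfies the projection inequality,
and the Bregman divergence is nonnegative. -/
theorem diverg_add_diverg_le (hf : IsSmoothConvex f β) (hQ : Convex ℝ Q) (hS : IsCompact S)
    {w w' y : E₁} {μ₂ p q : E₂} {ℓ ε : ℝ}
    (hn : IsSolution (projCost f A b Q w μ₂ ℓ) (posMeasures S) n)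
    (hw' : w' = (1 + mass n)⁻¹ • (w + mean n))
    (hp : IsSolution (fun q => ‖shifted A b μ₂ n - q‖) Q p) (hq : q ∈ Q)
    (hcut : ∀ k ∈ S, cut f A b y q k ≤ ℓ + ε) :
    diverg f w' p y q + diverg f w μ₂ w' p ≤ diverg f w μ₂ y q + mass n * ε := by
  have hs : 0 ≤ mass n := mass_nonneg n
  have h1 := projCost_first_order hf hQ hn hw' hp
    fun ε _ hε => exists_posMeasures_scale hn.1 hε
  -- Riesz representation in `E₁` replaces the adjoint of `A`, since `E₂` is not assumed complete
  -- here.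
  obtain ⟨c, hc⟩ : ∃ c : E₁, ∀ v, ⟪c, v⟫_ℝ = ⟪gradient f y, v⟫_ℝ + ⟪q, A v⟫_ℝ := by
    refine ⟨(InnerProductSpace.toDual ℝ E₁).symm ((innerSL ℝ (gradient f y)) +
      (innerSL ℝ q).comp A), fun v => ?_⟩
    rw [InnerProductSpace.toDual_symm_apply]
    simp
  have h2 := mass_mul_le_inner_mean hS hn.1
    (a := ⟪gradient f y, y⟫_ℝ - f y + ⟪q, b⟫_ℝ - ℓ - ε) (c := c) (fun v hv => by
      have := hcut v hv
      unfold cut at this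
      rw [hc]; linarith)
  rw [hc] at h2
  have h3 := hp.inner_sub_le_zero hQ q hq
  have h4 := mul_nonneg hs (hf.bregman_nonneg w' y)
  have hw : w = (1 + mass n) • w' - mean n := by
    rw [hw', smul_smul, mul_inv_cancel₀ (by linarith), one_smul]; abel
  simp only [diverg, bregman] at h4 ⊢
  simp only [← real_inner_self_eq_norm_sq]
  simp only [shifted] at h3
  have key : ∀ x : E₁, ⟪x, w⟫_ℝ = (1 + mass n) * ⟪x, w'⟫_ℝ - ⟪x, mean n⟫_ℝ := fun x => by
    conv_lhs => rw [hw]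
    rw [inner_sub_right, inner_smul_right]
  simp only [inner_sub_left, inner_sub_right, inner_add_left, inner_smul_left,
    inner_smul_right, inner_neg_right, map_neg, key, RCLike.conj_to_real] at h1 h2 h3 h4 ⊢
  simp only [real_inner_comm _ (A (mean n)), real_inner_comm q p, real_inner_comm _ μ₂,
    real_inner_comm _ b] at h1 h2 h3 h4 ⊢
  linarith

end Projection

/-! ### Closed convex hulls -/

section Hull

variable {H : Type*} [NormedAddCommGroup H] [InnerProductSpace ℝ H] {S T : Set H}

theorem subset_cconv (S : Set H) : S ⊆ cconv S := (subset_convexHull ℝ S).trans subset_closure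

theorem cconv_subset (hT : IsClosed T) (hT' : Convex ℝ T) (h : S ⊆ T) : cconv S ⊆ T :=
  closure_minimal (convexHull_min h hT') hT

theorem convex_cconv (S : Set H) : Convex ℝ (cconv S) := (convex_convexHull ℝ S).closure

theorem isClosed_cconv (S : Set H) : IsClosed (cconv S) := isClosed_closure

theorem cconv_mono (h : S ⊆ T) : cconv S ⊆ cconv T :=
  cconv_subset (isClosed_cconv T) (convex_cconv T) (h.trans (subset_cconv T))

theorem isCompact_cconv [CompleteSpace H] (hS : IsCompact S) : IsCompact (cconv S) :=
  hS.totallyBounded.convexHull.closure.isCompact_of_isClosed isClosed_closure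

end Hull

/-! ### Minimax duality and the qualification condition -/

section Duality

variable {E₁ E₂ : Type*}
  [NormedAddCommGroup E₁] [InnerProductSpace ℝ E₁]
  [NormedAddCommGroup E₂] [InnerProductSpace ℝ E₂]
  {f : E₁ → ℝ} {β : ℝ≥0} {A : E₁ →L[ℝ] E₂} {b : E₂} {Q Q₁ Q₂ : Set E₂} {X : Set E₁}

/-- The qualification condition yields a point of finite cost. -/
theorem exists_cost_ne_top (hQ : Q = Q₁ + Q₂) (hQ₁ : Bornology.IsBounded Q₁) {Kinit : Set E₁}
    (hqualif : -b ∈ interior (polar Q₂ - A '' cconv Kinit)) :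
    ∃ k ∈ cconv Kinit, cost f A b Q k ≠ ⊤ := by
  obtain ⟨p, hp, _, ⟨k, hk, rfl⟩, hpk⟩ := interior_subset hqualif
  simp only at hpk
  obtain ⟨B, hB⟩ := hQ₁.exists_norm_le
  refine ⟨k, hk, ?_⟩
  have hpe : A k - b = p := by rw [sub_eq_add_neg, ← hpk]; abel
  have : supp Q (A k - b) ≤ ((‖p‖ * B : ℝ) : EReal) := by
    refine iSup₂_le fun q hq => ?_
    obtain ⟨q₁, hq₁, q₂, hq₂, rfl⟩ := hQ ▸ hq
    rw [EReal.coe_le_coe_iff, hpe]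
    have h1 : ⟪p, q₁⟫_ℝ ≤ ‖p‖ * B := (real_inner_le_norm _ _).trans
      (mul_le_mul_of_nonneg_left (hB _ hq₁) (norm_nonneg _))
    have h2 : ⟪q₂, p⟫_ℝ ≤ 0 := hp q₂ hq₂
    rw [real_inner_comm] at h2
    simp only [inner_add_right]
    linarith
  refine ne_top_of_le_ne_top (EReal.coe_ne_top (f k + ‖p‖ * B)) ?_
  rw [EReal.coe_add]
  exact add_le_add le_rfl this

variable [CompleteSpace E₁]

/-- Approximate dual solutions of the problem of minimizing `f(x) + σ_Q(A x - b)` over a compact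
convex set. -/
theorem exists_cut_le_of_forall_exists_lt (hf : IsSmoothConvex f β) (hQ : Convex ℝ Q)
    (hX : IsCompact X) (hX' : Convex ℝ X) (hne : X.Nonempty) {c : ℝ}
    (h : ∀ x ∈ X, ∃ q ∈ Q, c < f x + ⟪q, A x - b⟫_ℝ) :
    ∃ q ∈ Q, ∃ y ∈ X, ∀ x ∈ X, cut f A b y q x ≤ -c := by
  have hcont : ∀ q : E₂, Continuous fun x => f x + ⟪q, A x - b⟫_ℝ := fun q =>
    hf.diff.continuous.add (continuous_const.inner (A.continuous.sub continuous_const))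
  -- `Q` need not be compact, so no optimal `q` is sought: compactness of `X` reduces the strict
  -- inequality to finitely many `q`, and Sion's argument merges them into a single one.
  obtain ⟨s, hsQ, hs, hcov⟩ := hX.elim_finite_subcover_image
    (b := Q) (c := fun q => {x | c < f x + ⟪q, A x - b⟫_ℝ})
    (fun q _ => isOpen_lt continuous_const (hcont q))
    (fun x hx => by simpa using h x hx)
  have hcv : ∀ q : E₂, ConvexOn ℝ X fun x => f x + ⟪q, A x - b⟫_ℝ := fun q => by
    refine (hf.convex.subset (subset_univ _) hX').add ⟨hX', fun x _ y _ s t _ _ hst => ?_⟩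
    simp only [map_add, map_smul, inner_sub_right, inner_add_right, inner_smul_right, smul_eq_mul]
    have : s * ⟪q, b⟫_ℝ + t * ⟪q, b⟫_ℝ = ⟪q, b⟫_ℝ := by rw [← add_mul, hst, one_mul]
    linarith
  obtain ⟨q, hq, hlt⟩ := Sion.exists_lt_iInf_of_lt_iInf_of_finite
    (f := fun x q => f x + ⟪q, A x - b⟫_ℝ) hne hX
    (fun q _ => (hcont q).lowerSemicontinuous.lowerSemicontinuousOn X)
    (fun q _ => (hcv q).quasiconvexOn) hQ
    (fun x _ => Continuous.upperSemicontinuous (by fun_prop) |>.upperSemicontinuousOn Q)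
    (fun x _ => ConcaveOn.quasiconcaveOn ⟨hQ, fun p _ q _ s t _ _ hst => by
      simp only [inner_add_left, inner_smul_left, smul_eq_mul, RCLike.conj_to_real]
      have : s * f x + t * f x = f x := by rw [← add_mul, hst, one_mul]
      linarith⟩) hX' hs hsQ
    (fun x hx => by simpa using hcov hx)
  obtain ⟨y, hy, hmin⟩ := hX.exists_isMinOn hne (hcont q).continuousOn
  refine ⟨q, hq, y, hy, fun x hx => ?_⟩
  -- Optimality of `y` allows `f` to be replaced by its tangent at `y`, which turns the Lagrangian
  -- bound into a bound on cuts.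
  have hfo : 0 ≤ ⟪gradient f y, x - y⟫_ℝ + ⟪q, A (x - y)⟫_ℝ := by
    refine nonneg_of_quadratic_bound (M := β * ‖x - y‖ ^ 2) fun ε hε hε1 => ?_
    have hmem : y + ε • (x - y) ∈ X := hX'.add_smul_sub_mem hy hx ⟨hε.le, hε1⟩
    have h1 := isMinOn_iff.1 hmin _ hmem
    have h2 := hf.descent y (y + ε • (x - y))
    rw [add_sub_cancel_left, inner_smul_right, norm_smul, mul_pow, Real.norm_eq_abs,
      sq_abs] at h2
    simp only [map_add, map_smul, inner_sub_right, inner_add_right, inner_smul_right] at h1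
    linarith
  have h3 := hlt y hy
  simp only [map_sub, inner_sub_right] at hfo h3
  unfold cut; linarith

/-- The qualification condition bounds the second component of dual points. -/
theorem exists_norm_le_of_cut_le (hf : IsSmoothConvex f β) (hQ : Q = Q₁ + Q₂)
    (hQ₁ : Bornology.IsBounded Q₁) {Kinit : Set E₁} (hK : IsCompact Kinit)
    (hqualif : -b ∈ interior (polar Q₂ - A '' cconv Kinit)) (c : ℝ) :
    ∃ M : ℝ, ∀ (w : E₁) (q : E₂), q ∈ Q → (∀ k ∈ Kinit, cut f A b w q k ≤ c) → ‖q‖ ≤ M := by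
  obtain ⟨r, hr, hball⟩ := Metric.mem_nhds_iff.1 (mem_interior_iff_mem_nhds.1 hqualif)
  obtain ⟨B, hB⟩ := hQ₁.exists_norm_le
  have hcK := isCompact_cconv hK
  obtain ⟨R, hR⟩ := hcK.isBounded.exists_norm_le
  obtain ⟨F, hF⟩ := (hcK.bddAbove_image (f := f) hf.diff.continuous.continuousOn)
  refine ⟨(c + F + B * (‖b‖ + r / 2 + ‖A‖ * R)) / (r / 2), fun w q hq hcut => ?_⟩
  obtain ⟨q₁, hq₁, q₂, hq₂, hqq⟩ := hQ ▸ hq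
  simp only at hqq
  -- Moving `-b` by `r / 2` in the direction of `q` stays in the ball and makes `⟪q, u⟫`
  -- proportional to `‖q‖`. If `q = 0`, division by zero gives `u = 0`, which is harmless.
  set u : E₂ := (r / 2 / ‖q‖) • q with hu
  have hun : ‖u‖ ≤ r / 2 := by
    rw [hu, norm_smul, norm_div, norm_norm, Real.norm_of_nonneg (by positivity)]
    rcases eq_or_ne ‖q‖ 0 with h | h
    · rw [h, mul_zero]; positivity
    · exact (div_mul_cancel₀ _ h).le
  have hqu : ⟪q, u⟫_ℝ = r / 2 * ‖q‖ := by
    rw [hu, inner_smul_right, real_inner_self_eq_norm_sq]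
    rcases eq_or_ne ‖q‖ 0 with h | h
    · simp [h]
    · field_simp
  obtain ⟨p, hp, _, ⟨k, hk, rfl⟩, hpk⟩ := hball (show -b + u ∈ Metric.ball (-b) r by
    rw [mem_ball_iff_norm, add_sub_cancel_left]; linarith)
  simp only at hpk
  -- Cuts are affine and continuous in `k`, so the bound passes to the closed convex hull.
  have hcutk : cut f A b w q k ≤ c := by
    refine cconv_subset (T := {k | cut f A b w q k ≤ c}) ?_ ?_ hcut hk
    · refine isClosed_le ?_ continuous_const
      unfold cut
      fun_prop
    · intro x hx y hy s t hs ht hst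
      simp only [mem_ofPred_eq, cut, map_add, map_smul, inner_add_right, inner_smul_right] at *
      have e : t = 1 - s := by linarith
      subst e
      nlinarith
  -- The terms in `w` are bounded by `f k`, so the final bound does not depend on `w`.
  have hgr := hf.gradient_le w k
  rw [inner_sub_right] at hgr
  have hFk : f k ≤ F := hF ⟨k, hk, rfl⟩
  have hpe : p = -b + u + A k := by rw [← hpk]; abel
  have hpn : ‖p‖ ≤ ‖b‖ + r / 2 + ‖A‖ * R := by
    rw [hpe]
    refine (norm_add_le _ _).trans (add_le_add ((norm_add_le _ _).trans ?_) ?_)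
    · rw [norm_neg]; linarith
    · exact (A.le_opNorm k).trans (mul_le_mul_of_nonneg_left (hR k hk) (norm_nonneg _))
  have h1 : ⟪q₁, p⟫_ℝ ≤ B * (‖b‖ + r / 2 + ‖A‖ * R) :=
    (real_inner_le_norm _ _).trans (mul_le_mul (hB _ hq₁) hpn (norm_nonneg _)
      ((norm_nonneg _).trans (hB _ hq₁)))
  have h2 : ⟪q₂, p⟫_ℝ ≤ 0 := hp q₂ hq₂
  have h3 : ⟪q, p⟫_ℝ = ⟪q₁, p⟫_ℝ + ⟪q₂, p⟫_ℝ := by rw [← hqq, inner_add_left]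
  rw [hpe, inner_add_right, inner_add_right, inner_neg_right, hqu, ← hpe] at h3
  unfold cut at hcutk
  rw [le_div_iff₀ (by positivity)]
  linarith

end Duality

section Lift

/-! ### The lifted primal update -/

variable {E₁ E₂ : Type*}
  [NormedAddCommGroup E₁] [InnerProductSpace ℝ E₁] [MeasurableSpace E₁]
  [NormedAddCommGroup E₂] [InnerProductSpace ℝ E₂]

theorem withLp_prod_ext {α γ : Type*} {x y : WithLp 2 (α × γ)} (h₁ : x.fst = y.fst)
    (h₂ : x.snd = y.snd) : x = y :=
  WithLp.ofLp_injective 2 (Prod.ext h₁ h₂)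

/-- The map `y ↦ (y, A y)` is continuous and linear with closed graph, so it commutes with closed
convex hulls; each inclusion follows from minimality of a hull. -/
theorem mem_neg_Etilde_iff (T : Trace E₁ E₂) (A : E₁ →L[ℝ] E₂) (t : ℕ)
    (x : WithLp 2 (E₁ × E₂)) :
    x ∈ -T.Etilde A t ↔ x.fst ∈ T.Ktilde t ∧ x.snd = A x.fst := by
  constructor
  · intro hx
    have hsub : T.Etilde A t ⊆ {x | -x.fst ∈ T.Ktilde t ∧ x.snd = A x.fst} := by
      refine cconv_subset ?_ ?_ ?_
      · refine IsClosed.and ?_ (isClosed_eq ?_ ?_)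
        · exact (isClosed_cconv _).preimage (WithLp.continuous_fst ..).neg
        · exact WithLp.continuous_snd ..
        · exact A.continuous.comp (WithLp.continuous_fst ..)
      · rintro x ⟨hx1, hx2⟩ y ⟨hy1, hy2⟩ r s hr hs hrs
        refine ⟨?_, by simp [hx2, hy2]⟩
        have := convex_cconv _ hx1 hy1 hr hs hrs
        rw [smul_neg, smul_neg, ← neg_add] at this
        exact this
      · rintro x (⟨hx1, hx2⟩ | rfl)
        · exact ⟨subset_cconv _ (Or.inl hx1), hx2⟩
        · exact ⟨subset_cconv _ (Or.inr rfl), rfl⟩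
    have := hsub (Set.mem_neg.1 hx)
    simpa using this
  · rintro ⟨hx1, hx2⟩
    have hsub : T.Ktilde t ⊆ {y | -WithLp.toLp 2 (y, A y) ∈ T.Etilde A t} := by
      refine cconv_subset ?_ ?_ ?_
      · refine (isClosed_cconv _).preimage ?_
        fun_prop
      · intro x hx y hy r s hr hs hrs
        have := convex_cconv _ hx hy hr hs hrs
        have e : -WithLp.toLp 2 (r • x + s • y, A (r • x + s • y))
            = r • -WithLp.toLp 2 (x, A x) + s • -WithLp.toLp 2 (y, A y) := by
          rw [smul_neg, smul_neg, ← neg_add]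
          congr 1
          apply withLp_prod_ext <;> simp
        rw [mem_ofPred_eq, e]
        exact this
      · rintro x (hx | rfl)
        · refine subset_cconv _ (Or.inl ⟨?_, ?_⟩)
          · simpa using hx
          · simp
        · refine subset_cconv _ (Or.inr ?_)
          rw [mem_singleton_iff]
          apply withLp_prod_ext <;> simp
    have e : x = WithLp.toLp 2 (x.fst, A x.fst) :=
      withLp_prod_ext rfl hx2
    rw [Set.mem_neg, e]
    exact hsub hx1

end Lift

/-! ### Executions with bounded cuts -/

variable {E₁ E₂ : Type*}
  [NormedAddCommGroup E₁] [InnerProductSpace ℝ E₁] [CompleteSpace E₁]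
  [MeasurableSpace E₁]
  [NormedAddCommGroup E₂] [InnerProductSpace ℝ E₂] [CompleteSpace E₂]

/-- An execution of the method whose cuts lie in the ball of radius `R`, together with the
assumptions on the data. -/
structure BoundedRun (f : E₁ → ℝ) (β : ℝ≥0) (A : E₁ →L[ℝ] E₂) (b : E₂) (Q Q₁ Q₂ : Set E₂)
    (K Kinit : Set E₁) (lam : ℝ) (T : Trace E₁ E₂) (R : ℝ) : Prop where
  smooth : IsSmoothConvex f β
  β_pos : 0 < β
  Q_eq : Q = Q₁ + Q₂
  Q_ne : Q.Nonempty
  Q_convex : Convex ℝ Q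
  Q₁_bdd : Bornology.IsBounded Q₁
  K_closed : IsClosed K
  K_convex : Convex ℝ K
  Kinit_compact : IsCompact Kinit
  Kinit_sub : Kinit ⊆ K
  qualif : -b ∈ interior (polar Q₂ - A '' cconv Kinit)
  lam_mem : lam ∈ Ioo (0 : ℝ) 1
  run : IsRun f A b Q K Kinit lam T
  Kinit_norm : ∀ k ∈ Kinit, ‖k‖ ≤ R
  v_norm : ∀ t, ‖T.v t‖ ≤ R
  w_norm : ‖T.w 0‖ ≤ R

namespace BoundedRun

variable {f : E₁ → ℝ} {β : ℝ≥0} {A : E₁ →L[ℝ] E₂} {b : E₂} {Q Q₁ Q₂ : Set E₂}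
  {K Kinit : Set E₁} {lam : ℝ} {T : Trace E₁ E₂} {R : ℝ}

/-! ### The sets of cuts -/

theorem neg_v_mem (h : BoundedRun f β A b Q Q₁ Q₂ K Kinit lam T R) (t : ℕ) :
    -T.v t ∈ K ∩ Metric.closedBall 0 R :=
  ⟨(h.run.oracle t).1, by simpa using h.v_norm t⟩

theorem Ktilde_subset_of (h : BoundedRun f β A b Q Q₁ Q₂ K Kinit lam T R) {t : ℕ}
    (ht : T.KBefore t ⊆ K ∩ Metric.closedBall 0 R) : T.Ktilde t ⊆ K ∩ Metric.closedBall 0 R :=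
  cconv_subset (h.K_closed.inter Metric.isClosed_closedBall)
    (h.K_convex.inter (convex_closedBall 0 R))
    (union_subset ht (singleton_subset_iff.2 (h.neg_v_mem t)))

theorem Kcut_subset_Ktilde (h : BoundedRun f β A b Q Q₁ Q₂ K Kinit lam T R) (t : ℕ) :
    T.Kcut t ⊆ T.Ktilde t := by
  by_cases hp : T.Δ f A b Q t < ((1 - lam : ℝ) : EReal) * T.ΔbarBefore t
  · exact (h.run.prune t hp).1
  · rw [(h.run.no_prune t hp).1]
    exact subset_cconv _

theorem KBefore_spec (h : BoundedRun f β A b Q Q₁ Q₂ K Kinit lam T R) (t : ℕ) :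
    IsSimpleSet Kinit (T.KBefore t) ∧ T.KBefore t ⊆ K ∩ Metric.closedBall 0 R := by
  induction t with
  | zero =>
    rw [h.run.init_K]
    exact ⟨⟨∅, finite_empty, (union_empty _).symm⟩,
      fun k hk => ⟨h.Kinit_sub hk, by simpa using h.Kinit_norm k hk⟩⟩
  | succ t ih =>
    refine ⟨?_, (h.Kcut_subset_Ktilde t).trans (h.Ktilde_subset_of ih.2)⟩
    by_cases hp : T.Δ f A b Q t < ((1 - lam : ℝ) : EReal) * T.ΔbarBefore t
    · exact (h.run.prune t hp).2.1
    · obtain ⟨S, hS, hKS⟩ := ih.1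
      refine ⟨S ∪ {-T.v t}, hS.union (finite_singleton _), ?_⟩
      rw [← union_assoc, ← hKS]
      exact (h.run.no_prune t hp).1

theorem Ktilde_subset (h : BoundedRun f β A b Q Q₁ Q₂ K Kinit lam T R) (t : ℕ) :
    T.Ktilde t ⊆ K ∩ Metric.closedBall 0 R :=
  h.Ktilde_subset_of (h.KBefore_spec t).2

theorem Kinit_subset_KBefore (h : BoundedRun f β A b Q Q₁ Q₂ K Kinit lam T R) (t : ℕ) :
    Kinit ⊆ T.KBefore t := by
  obtain ⟨S, -, hS⟩ := (h.KBefore_spec t).1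
  rw [hS]
  exact subset_union_left

theorem isCompact_KBefore (h : BoundedRun f β A b Q Q₁ Q₂ K Kinit lam T R) (t : ℕ) :
    IsCompact (T.KBefore t) := by
  obtain ⟨S, hS, hKS⟩ := (h.KBefore_spec t).1
  rw [hKS]
  exact h.Kinit_compact.union hS.isCompact

theorem isCompact_Ktilde (h : BoundedRun f β A b Q Q₁ Q₂ K Kinit lam T R) (t : ℕ) :
    IsCompact (T.Ktilde t) :=
  isCompact_cconv ((h.isCompact_KBefore t).union isCompact_singleton)

/-- Pruning is required to keep the primal iterate in the hull; this makes the primal values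
monotone. -/
theorem xhat_mem_Ktilde_succ (h : BoundedRun f β A b Q Q₁ Q₂ K Kinit lam T R) (t : ℕ) :
    T.xhat t ∈ T.Ktilde (t + 1) := by
  have : T.xhat t ∈ cconv (T.Kcut t) := by
    by_cases hp : T.Δ f A b Q t < ((1 - lam : ℝ) : EReal) * T.ΔbarBefore t
    · exact (h.run.prune t hp).2.2.1
    · rw [(h.run.no_prune t hp).1]
      exact (h.run.xhat_sol t).1
  exact cconv_mono subset_union_left this

/-! ### The dual points -/

theorem μ₁_eq (h : BoundedRun f β A b Q Q₁ Q₂ K Kinit lam T R) (t : ℕ) :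
    (T.μ t).fst = gradient f (T.w t) := by
  cases t with
  | zero => exact h.smooth.eq_gradient_of_mem_subdiff_conj h.run.init_w
  | succ t => exact h.run.μ₁_next t

theorem μ₂_mem (h : BoundedRun f β A b Q Q₁ Q₂ K Kinit lam T R) (t : ℕ) : (T.μ t).snd ∈ Q := by
  cases t with
  | zero => exact h.run.init_μ₂
  | succ t => exact (h.run.μ₂_next t).1

/-- Each new `w` averages the old one, with weight `1`, and cuts in the ball, with total weight the
mass of `n`. -/
theorem norm_w_le (h : BoundedRun f β A b Q Q₁ Q₂ K Kinit lam T R) (t : ℕ) : ‖T.w t‖ ≤ R := by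
  induction t with
  | zero => exact h.w_norm
  | succ t ih =>
    have hs : 0 ≤ mass (T.n t) := mass_nonneg _
    have he : ‖mean (T.n t)‖ ≤ R * mass (T.n t) := norm_mean_le
      (fun v hv => by simpa using ((h.KBefore_spec (t + 1)).2 hv).2) (h.run.n_sol t).1
    rw [h.run.w_next, norm_smul, norm_inv, Real.norm_of_nonneg (by linarith),
      inv_mul_le_iff₀ (by linarith)]
    have := norm_add_le (T.w t) (mean (T.n t))
    linarith

/-- The cut produced by the oracle is the dual cost. -/
theorem dualCost_eq (h : BoundedRun f β A b Q Q₁ Q₂ K Kinit lam T R) (t : ℕ) :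
    dualCost f A b Q K (T.μ t) = (cut f A b (T.w t) (T.μ t).snd (-T.v t) : EReal) := by
  have hs : supp (-graphOver A K) (T.μ t)
      = ((⟪(T.μ t).fst + A.adjoint (T.μ t).snd, T.v t⟫_ℝ : ℝ) : EReal) := by
    refine le_antisymm (iSup₂_le fun x hx => ?_) ?_
    · rw [Set.mem_neg] at hx
      obtain ⟨hx1, hx2⟩ := hx
      have := (h.run.oracle t).2 _ hx1
      simp only [WithLp.neg_fst, WithLp.neg_snd, map_neg, neg_inj, inner_neg_right] at this hx2
      rw [EReal.coe_le_coe_iff, WithLp.prod_inner_apply]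
      rw [inner_add_left, inner_add_left, A.adjoint_inner_left, A.adjoint_inner_left] at this
      rw [inner_add_left, A.adjoint_inner_left]
      change ⟪(T.μ t).fst, x.fst⟫_ℝ + ⟪(T.μ t).snd, x.snd⟫_ℝ ≤ _
      rw [hx2]
      linarith
    · have hm : WithLp.toLp 2 (T.v t, A (T.v t)) ∈ -graphOver A K := by
        rw [Set.mem_neg]
        exact ⟨(h.run.oracle t).1, by simp⟩
      refine le_trans (le_of_eq ?_) (le_iSup₂ (f := fun x (_ : x ∈ -graphOver A K) =>
        ((⟪T.μ t, x⟫_ℝ : ℝ) : EReal)) _ hm)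
      rw [EReal.coe_eq_coe_iff, WithLp.prod_inner_apply, inner_add_left, A.adjoint_inner_left]
      rfl
  rw [dualCost, hs, h.μ₁_eq, h.smooth.conj_gradient, indic, if_pos (h.μ₂_mem t), add_zero,
    ← EReal.coe_add, ← EReal.coe_add, EReal.coe_eq_coe_iff, cut, inner_add_left,
    A.adjoint_inner_left, map_neg, inner_neg_right, inner_neg_right]
  ring

theorem hbar_eq_min (h : BoundedRun f β A b Q Q₁ Q₂ K Kinit lam T R) (t : ℕ) :
    T.hbar t = min (T.hbarBefore t) (cut f A b (T.w t) (T.μ t).snd (-T.v t) : ℝ) := by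
  rw [h.run.hbar_eq, h.μ₁_eq]
  congr 2
  rw [cut, inner_add_left, A.adjoint_inner_left, map_neg, inner_neg_right, inner_neg_right]
  ring

theorem exists_hbar_eq (h : BoundedRun f β A b Q Q₁ Q₂ K Kinit lam T R) (t : ℕ) :
    ∃ s, T.hbar t = (cut f A b (T.w s) (T.μ s).snd (-T.v s) : ℝ) ∧ T.μhat t = T.μ s := by
  have hnew : ∀ t, T.hbar t < T.hbarBefore t →
      T.hbar t = (cut f A b (T.w t) (T.μ t).snd (-T.v t) : ℝ) ∧ T.μhat t = T.μ t := by
    intro t ht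
    refine ⟨?_, h.run.μhat_new t ht⟩
    rw [h.hbar_eq_min] at ht ⊢
    rw [min_lt_iff] at ht
    exact min_eq_right (ht.resolve_left (lt_irrefl _)).le
  induction t with
  | zero =>
    refine ⟨0, hnew 0 ?_⟩
    rw [h.hbar_eq_min, h.run.init_hbar]
    simp
  | succ t ih =>
    by_cases ht : T.hbar (t + 1) < T.hbarBefore (t + 1)
    · exact ⟨t + 1, hnew _ ht⟩
    · obtain ⟨s, hs1, hs2⟩ := ih
      refine ⟨s, ?_, (h.run.μhat_old _ ht).trans hs2⟩
      rw [← hs1]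
      refine le_antisymm ?_ (not_lt.1 ht)
      rw [h.hbar_eq_min]
      exact min_le_left _ _

theorem dualCost_μhat (h : BoundedRun f β A b Q Q₁ Q₂ K Kinit lam T R) (t : ℕ) :
    dualCost f A b Q K (T.μhat t) = T.hbar t := by
  obtain ⟨s, hs1, hs2⟩ := h.exists_hbar_eq t
  rw [hs1, hs2, h.dualCost_eq]

/-- Weak duality: `f` is bounded below by its tangent, the support function by its value at `μ₂`,
and the oracle minimizes the resulting linear form over `K`. -/
theorem neg_cut_le_cost (h : BoundedRun f β A b Q Q₁ Q₂ K Kinit lam T R) (s : ℕ) {x : E₁}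
    (hx : x ∈ K) :
    ((-cut f A b (T.w s) (T.μ s).snd (-T.v s) : ℝ) : EReal) ≤ cost f A b Q x := by
  have h1 : ((⟪A x - b, (T.μ s).snd⟫_ℝ : ℝ) : EReal) ≤ supp Q (A x - b) :=
    le_iSup₂ (f := fun q (_ : q ∈ Q) => ((⟪A x - b, q⟫_ℝ : ℝ) : EReal)) _ (h.μ₂_mem s)
  refine le_trans ?_ (add_le_add le_rfl h1)
  rw [← EReal.coe_add, EReal.coe_le_coe_iff]
  have h2 := (h.run.oracle s).2 x hx
  simp only [h.μ₁_eq] at h2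
  rw [inner_add_left, inner_add_left, A.adjoint_inner_left, A.adjoint_inner_left] at h2
  have h3 := h.smooth.gradient_le (T.w s) x
  rw [real_inner_comm, inner_sub_right]
  rw [inner_sub_right] at h3
  unfold cut
  linarith

/-! ### Real values of the bounds -/

theorem cost_xhat (h : BoundedRun f β A b Q Q₁ Q₂ K Kinit lam T R) (t : ℕ) :
    ((cost f A b Q (T.xhat t)).toReal : EReal) = cost f A b Q (T.xhat t) := by
  refine EReal.coe_toReal ?_ ?_
  · obtain ⟨k, hk, hk'⟩ := exists_cost_ne_top (f := f) h.Q_eq h.Q₁_bdd h.qualif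
    exact ne_top_of_le_ne_top hk' ((h.run.xhat_sol t).2 k
      (cconv_mono ((h.Kinit_subset_KBefore t).trans subset_union_left) hk))
  · exact ne_bot_of_le_ne_bot (EReal.coe_ne_bot _)
      (h.neg_cut_le_cost 0 (h.Ktilde_subset t (h.run.xhat_sol t).1).1)

theorem hbar_coe (h : BoundedRun f β A b Q Q₁ Q₂ K Kinit lam T R) (t : ℕ) :
    ((T.hbar t).toReal : EReal) = T.hbar t := by
  obtain ⟨s, hs, -⟩ := h.exists_hbar_eq t
  rw [hs, EReal.toReal_coe]

end BoundedRun

/-- The real value of the gap. -/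
def Trace.gap (T : Trace E₁ E₂) (f : E₁ → ℝ) (A : E₁ →L[ℝ] E₂) (b : E₂) (Q : Set E₂) (t : ℕ) :
    ℝ :=
  (T.hbar t).toReal + (cost f A b Q (T.xhat t)).toReal

/-- The real value of `Δ̄` at the end of iteration `t`. -/
def Trace.gapRef (T : Trace E₁ E₂) (t : ℕ) : ℝ := (T.ΔbarBefore (t + 1)).toReal

namespace BoundedRun

variable {f : E₁ → ℝ} {β : ℝ≥0} {A : E₁ →L[ℝ] E₂} {b : E₂} {Q Q₁ Q₂ : Set E₂}
  {K Kinit : Set E₁} {lam : ℝ} {T : Trace E₁ E₂} {R : ℝ}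

theorem Δ_eq_gap (h : BoundedRun f β A b Q Q₁ Q₂ K Kinit lam T R) (t : ℕ) :
    T.Δ f A b Q t = (T.gap f A b Q t : EReal) := by
  rw [Trace.Δ, Trace.hunder, sub_eq_add_neg, neg_neg, ← h.cost_xhat, ← h.hbar_coe, Trace.gap,
    EReal.coe_add]

theorem level_eq (h : BoundedRun f β A b Q Q₁ Q₂ K Kinit lam T R) (t : ℕ) :
    T.level f A b Q lam t
      = (((T.hbar t).toReal - (1 - lam) * T.gap f A b Q t : ℝ) : EReal) := by
  rw [Trace.level, Trace.hunder, ← h.cost_xhat, ← h.hbar_coe, ← EReal.coe_neg, ← EReal.coe_mul,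
    ← EReal.coe_mul, ← EReal.coe_add, EReal.coe_eq_coe_iff, Trace.gap, EReal.toReal_coe]
  ring

theorem gap_eq_cost_add_dualCost (h : BoundedRun f β A b Q Q₁ Q₂ K Kinit lam T R) (t : ℕ) :
    T.Δ f A b Q t = (cost f A b Q (T.xhat t) + indic K (T.xhat t))
      + dualCost f A b Q K (T.μhat t) := by
  rw [h.dualCost_μhat, indic, if_pos (h.Ktilde_subset t (h.run.xhat_sol t).1).1, add_zero,
    h.Δ_eq_gap, Trace.gap, EReal.coe_add, h.cost_xhat, h.hbar_coe, add_comm]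

theorem exists_value_eq (h : BoundedRun f β A b Q Q₁ Q₂ K Kinit lam T R) :
    ∃ V : ℝ, value f A b Q K = V ∧ ∀ t, V ≤ (cost f A b Q (T.xhat t)).toReal ∧
      -V ≤ (T.hbar t).toReal := by
  have hle : ∀ t, value f A b Q K ≤ (cost f A b Q (T.xhat t)).toReal := fun t => by
    rw [h.cost_xhat]
    refine (iInf_le _ (T.xhat t)).trans ?_
    rw [indic, if_pos (h.Ktilde_subset t (h.run.xhat_sol t).1).1, add_zero]
  have hge : ∀ t, ((-(T.hbar t).toReal : ℝ) : EReal) ≤ value f A b Q K := fun t => by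
    obtain ⟨s, hs, -⟩ := h.exists_hbar_eq t
    rw [hs, EReal.toReal_coe]
    refine le_iInf fun x => ?_
    by_cases hx : x ∈ K
    · rw [indic, if_pos hx, add_zero]
      exact h.neg_cut_le_cost s hx
    · rw [indic, if_neg hx, EReal.add_top_of_ne_bot]
      · exact le_top
      · obtain ⟨q, hq⟩ := h.Q_ne
        refine ne_bot_of_le_ne_bot (EReal.coe_ne_bot (f x + ⟪A x - b, q⟫_ℝ)) ?_
        rw [EReal.coe_add]
        exact add_le_add le_rfl
          (le_iSup₂ (f := fun q (_ : q ∈ Q) => ((⟪A x - b, q⟫_ℝ : ℝ) : EReal)) q hq)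
  have hV : ((value f A b Q K).toReal : EReal) = value f A b Q K :=
    EReal.coe_toReal (ne_top_of_le_ne_top (EReal.coe_ne_top _) (hle 0))
      (ne_bot_of_le_ne_bot (EReal.coe_ne_bot _) (hge 0))
  refine ⟨_, hV.symm, fun t => ⟨?_, ?_⟩⟩
  · rw [← EReal.coe_le_coe_iff, hV]; exact hle t
  · rw [neg_le, ← EReal.coe_le_coe_iff, hV]; exact hge t

/-! ### Monotonicity of the gap and the reference gap -/

theorem gap_nonneg (h : BoundedRun f β A b Q Q₁ Q₂ K Kinit lam T R) (t : ℕ) :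
    0 ≤ T.gap f A b Q t := by
  obtain ⟨V, -, hV⟩ := h.exists_value_eq
  have := hV t
  unfold Trace.gap; linarith

theorem hbar_toReal_antitone (h : BoundedRun f β A b Q Q₁ Q₂ K Kinit lam T R) :
    Antitone fun t => (T.hbar t).toReal := by
  refine antitone_nat_of_succ_le fun t => ?_
  rw [← EReal.coe_le_coe_iff, h.hbar_coe, h.hbar_coe, h.hbar_eq_min (t + 1)]
  exact min_le_left _ _

theorem gap_antitone (h : BoundedRun f β A b Q Q₁ Q₂ K Kinit lam T R) :
    Antitone fun t => T.gap f A b Q t := by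
  refine antitone_nat_of_succ_le fun t => ?_
  have h1 : (cost f A b Q (T.xhat (t + 1))).toReal ≤ (cost f A b Q (T.xhat t)).toReal := by
    rw [← EReal.coe_le_coe_iff, h.cost_xhat, h.cost_xhat]
    exact (h.run.xhat_sol (t + 1)).2 _ (h.xhat_mem_Ktilde_succ t)
  exact add_le_add (h.hbar_toReal_antitone (Nat.le_succ t)) h1

/-- The initial value `+∞` forces pruning at iteration `0`, so the reference gap is finite from then
on. -/
theorem Δbar_zero (h : BoundedRun f β A b Q Q₁ Q₂ K Kinit lam T R) :
    T.ΔbarBefore 1 = (T.gap f A b Q 0 : EReal) := by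
  rw [← h.Δ_eq_gap]
  refine (h.run.prune 0 ?_).2.2.2
  have := h.lam_mem.2
  rw [h.run.init_Δbar, EReal.coe_mul_top_of_pos (by linarith), h.Δ_eq_gap]
  exact EReal.coe_lt_top _

theorem Δbar_coe (h : BoundedRun f β A b Q Q₁ Q₂ K Kinit lam T R) (t : ℕ) :
    (T.gapRef t : EReal) = T.ΔbarBefore (t + 1) := by
  unfold Trace.gapRef
  induction t with
  | zero => rw [h.Δbar_zero, EReal.toReal_coe]
  | succ t ih =>
    by_cases hp : T.Δ f A b Q (t + 1) < ((1 - lam : ℝ) : EReal) * T.ΔbarBefore (t + 1)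
    · rw [(h.run.prune _ hp).2.2.2, h.Δ_eq_gap, EReal.toReal_coe]
    · rw [(h.run.no_prune _ hp).2, ih]

theorem prune_iff (h : BoundedRun f β A b Q Q₁ Q₂ K Kinit lam T R) (t : ℕ) :
    T.Δ f A b Q (t + 1) < ((1 - lam : ℝ) : EReal) * T.ΔbarBefore (t + 1) ↔
      T.gap f A b Q (t + 1) < (1 - lam) * T.gapRef t := by
  rw [h.Δ_eq_gap, ← h.Δbar_coe, ← EReal.coe_mul, EReal.coe_lt_coe_iff]

theorem gapRef_zero (h : BoundedRun f β A b Q Q₁ Q₂ K Kinit lam T R) :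
    T.gapRef 0 = T.gap f A b Q 0 := by
  rw [Trace.gapRef, h.Δbar_zero, EReal.toReal_coe]

theorem gapRef_of_prune (h : BoundedRun f β A b Q Q₁ Q₂ K Kinit lam T R) {t : ℕ}
    (ht : T.gap f A b Q (t + 1) < (1 - lam) * T.gapRef t) :
    T.gapRef (t + 1) = T.gap f A b Q (t + 1) := by
  rw [Trace.gapRef, (h.run.prune _ ((h.prune_iff t).2 ht)).2.2.2, h.Δ_eq_gap, EReal.toReal_coe]

theorem gapRef_of_not_prune (h : BoundedRun f β A b Q Q₁ Q₂ K Kinit lam T R) {t : ℕ}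
    (ht : ¬ T.gap f A b Q (t + 1) < (1 - lam) * T.gapRef t) :
    T.gapRef (t + 1) = T.gapRef t := by
  rw [Trace.gapRef, (h.run.no_prune _ ((h.prune_iff t).not.2 ht)).2, Trace.gapRef]

theorem Kcut_of_not_prune (h : BoundedRun f β A b Q Q₁ Q₂ K Kinit lam T R) {t : ℕ}
    (ht : ¬ T.gap f A b Q (t + 1) < (1 - lam) * T.gapRef t) :
    T.Kcut (t + 1) = T.Kcut t ∪ {-T.v (t + 1)} :=
  (h.run.no_prune _ ((h.prune_iff t).not.2 ht)).1

theorem lifted_solution_iff (h : BoundedRun f β A b Q Q₁ Q₂ K Kinit lam T R) (t : ℕ)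
    (x : WithLp 2 (E₁ × E₂)) :
    (IsSolution (liftedCost f b Q) (-T.Etilde A t) x ∧ x.fst = T.xhat t) ↔
      (x.fst = T.xhat t ∧ x.snd = A (T.xhat t)) := by
  constructor
  · rintro ⟨hx, hx1⟩
    exact ⟨hx1, by rw [← hx1]; exact ((mem_neg_Etilde_iff T A t x).1 hx.1).2⟩
  · rintro ⟨hx1, hx2⟩
    refine ⟨⟨?_, fun y hy => ?_⟩, hx1⟩
    · rw [mem_neg_Etilde_iff, hx2, hx1]
      exact ⟨(h.run.xhat_sol t).1, rfl⟩
    · rw [mem_neg_Etilde_iff] at hy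
      have := (h.run.xhat_sol t).2 _ hy.1
      simpa only [cost, liftedCost, hx1, hx2, hy.2] using this

end BoundedRun

/-! ### Convergence rate -/

/-- If the lengths of the phases during which the reference gap is constant are at most inversely
proportional to its square, and the reference gap decreases geometrically from one phase to the
next, then the gap at time `t` is `O(1 / √t)`. -/
theorem exists_mul_gap_sq_le {gap ref : ℕ → ℝ} {a B : ℝ} (ha : 0 < a) (ha1 : a < 1)
    (hnn : ∀ t, 0 ≤ gap t) (hanti : Antitone gap)
    (hle : ∀ t, gap t ≤ ref t)
    (hp : ∀ t, gap (t + 1) < a * ref t → ref (t + 1) = gap (t + 1))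
    (hnp : ∀ t, ¬ gap (t + 1) < a * ref t → ref (t + 1) = ref t)
    (hB : ∀ t m : ℕ, (∀ j < m, ¬ gap (t + j + 1) < a * ref (t + j)) → m * ref t ^ 2 ≤ B) :
    ∃ C : ℝ, 0 < C ∧ ∀ t : ℕ, t * gap t ^ 2 ≤ C := by
  have hconst : ∀ t m : ℕ, (∀ j < m, ¬ gap (t + j + 1) < a * ref (t + j)) →
      ref (t + m) = ref t := by
    intro t m
    induction m with
    | zero => intro _; rfl
    | succ m ih =>
      intro h
      rw [← add_assoc, hnp _ (h m (Nat.lt_succ_self m)), ih fun j hj => h j (by omega)]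
  have hB0 : 0 ≤ B := by simpa using hB 0 0 (by simp)
  -- The fixed point of `c ↦ a² (c + B) + gap(0)²`, the map that propagates the bound on `s * ref s
  -- ^ 2` from one phase start to the next.
  set c := (a ^ 2 * B + gap 0 ^ 2) / (1 - a ^ 2) with hc
  have ha2 : 0 < 1 - a ^ 2 := by nlinarith
  have hc' : a ^ 2 * (c + B) + gap 0 ^ 2 = c := by
    rw [hc]; field_simp; ring
  have hc0 : 0 ≤ c := by positivity
  -- Here `s` is the start of the current phase and `m` the time elapsed in it.
  have inv : ∀ t : ℕ, ∃ s m : ℕ, t = s + m ∧ (∀ j < m, ¬ gap (s + j + 1) < a * ref (s + j)) ∧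
      s * ref s ^ 2 ≤ c := by
    intro t
    induction t with
    | zero => exact ⟨0, 0, rfl, by simp, by simpa using hc0⟩
    | succ t ih =>
      obtain ⟨s, m, rfl, hm, hs⟩ := ih
      by_cases h : gap (s + m + 1) < a * ref (s + m)
      · refine ⟨s + m + 1, 0, rfl, by simp, ?_⟩
        have e := hconst s m hm
        have hb := hB s m hm
        have h1 : ref (s + m + 1) ≤ a * ref s := by rw [hp _ h, ← e]; exact h.le
        have h2 : ref (s + m + 1) ≤ gap 0 := by rw [hp _ h]; exact hanti (Nat.zero_le _)
        have h3 : 0 ≤ ref (s + m + 1) := (hnn _).trans (hle _)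
        have h4 : ref (s + m + 1) ^ 2 ≤ a ^ 2 * ref s ^ 2 := by
          rw [← mul_pow]; exact pow_le_pow_left₀ h3 h1 2
        have h5 : ref (s + m + 1) ^ 2 ≤ gap 0 ^ 2 := pow_le_pow_left₀ h3 h2 2
        have h6 : ((s : ℝ) + m) * ref (s + m + 1) ^ 2 ≤ (s + m) * (a ^ 2 * ref s ^ 2) :=
          mul_le_mul_of_nonneg_left h4 (by positivity)
        have h7 : a ^ 2 * (s * ref s ^ 2 + m * ref s ^ 2) ≤ a ^ 2 * (c + B) :=
          mul_le_mul_of_nonneg_left (add_le_add hs hb) (by positivity)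
        push_cast
        linarith
      · refine ⟨s, m + 1, rfl, fun j hj => ?_, hs⟩
        rcases Nat.lt_succ_iff_lt_or_eq.1 hj with hj | rfl
        · exact hm j hj
        · exact h
  refine ⟨c + B + 1, by positivity, fun t => ?_⟩
  obtain ⟨s, m, rfl, hm, hs⟩ := inv t
  have hb := hB s m hm
  have h1 : gap (s + m) ^ 2 ≤ ref s ^ 2 := by
    rw [← hconst s m hm]; exact pow_le_pow_left₀ (hnn _) (hle _) 2
  have h2 := mul_le_mul_of_nonneg_left h1 (by positivity : (0 : ℝ) ≤ s + m)
  push_cast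
  linarith

namespace BoundedRun

variable {f : E₁ → ℝ} {β : ℝ≥0} {A : E₁ →L[ℝ] E₂} {b : E₂} {Q Q₁ Q₂ : Set E₂}
  {K Kinit : Set E₁} {lam : ℝ} {T : Trace E₁ E₂} {R : ℝ}

/-! ### Approximate dual solutions and the length of a phase -/

theorem exists_approx_dual (h : BoundedRun f β A b Q Q₁ Q₂ K Kinit lam T R) (t : ℕ) {ε : ℝ}
    (hε : 0 < ε) : ∃ q ∈ Q, ∃ y ∈ T.Ktilde t, ∀ x ∈ T.Ktilde t,
      cut f A b y q x ≤ -(cost f A b Q (T.xhat t)).toReal + ε := by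
  obtain ⟨q, hq, y, hy, hx⟩ := exists_cut_le_of_forall_exists_lt (A := A) (b := b) h.smooth
    h.Q_convex (h.isCompact_Ktilde t) (convex_cconv _) ⟨_, (h.run.xhat_sol t).1⟩
    (c := (cost f A b Q (T.xhat t)).toReal - ε) (fun x hx => by
      by_contra! hcon
      have hle : cost f A b Q x ≤ (((cost f A b Q (T.xhat t)).toReal - ε : ℝ) : EReal) := by
        have : supp Q (A x - b)
            ≤ (((cost f A b Q (T.xhat t)).toReal - ε - f x : ℝ) : EReal) := by
          refine iSup₂_le fun q hq => EReal.coe_le_coe_iff.2 ?_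
          have := hcon q hq
          rw [real_inner_comm]; linarith
        refine (add_le_add (le_refl (f x : EReal)) this).trans ?_
        rw [← EReal.coe_add, EReal.coe_le_coe_iff]
        linarith
      have := ((h.run.xhat_sol t).2 x hx).trans hle
      rw [← h.cost_xhat, EReal.coe_le_coe_iff, EReal.toReal_coe] at this
      linarith)
  exact ⟨q, hq, y, hy, fun x hx' => (hx x hx').trans (by linarith)⟩

theorem gap_le_gapRef (h : BoundedRun f β A b Q Q₁ Q₂ K Kinit lam T R) (t : ℕ) :
    T.gap f A b Q t ≤ T.gapRef t := by
  induction t with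
  | zero => exact h.gapRef_zero.ge
  | succ t ih =>
    by_cases ht : T.gap f A b Q (t + 1) < (1 - lam) * T.gapRef t
    · exact (h.gapRef_of_prune ht).ge
    · rw [h.gapRef_of_not_prune ht]
      exact (h.gap_antitone (Nat.le_succ t)).trans ih

theorem n_sol (h : BoundedRun f β A b Q Q₁ Q₂ K Kinit lam T R) (t : ℕ) :
    IsSolution (projCost f A b Q (T.w t) (T.μ t).snd
      (((T.hbar t).toReal - (1 - lam) * T.gap f A b Q t : ℝ) : EReal))
      (posMeasures (T.Kcut t)) (T.n t) := by
  rw [← h.level_eq]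
  exact h.run.n_sol t

variable [BorelSpace E₁]

theorem cut_next_le (h : BoundedRun f β A b Q Q₁ Q₂ K Kinit lam T R) (t : ℕ) {k : E₁}
    (hk : k ∈ T.Kcut t) :
    cut f A b (T.w (t + 1)) (T.μ (t + 1)).snd k
      ≤ (T.hbar t).toReal - (1 - lam) * T.gap f A b Q t :=
  cut_le_level h.smooth h.Q_convex (h.isCompact_KBefore (t + 1)) (h.n_sol t) (h.run.w_next t)
    (h.run.μ₂_next t) hk

theorem exists_norm_μ₂_le (h : BoundedRun f β A b Q Q₁ Q₂ K Kinit lam T R) :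
    ∃ M : ℝ, (∀ t, ‖(T.μ (t + 1)).snd‖ ≤ M) ∧ ∀ (t : ℕ) (y : E₁), ∀ q ∈ Q,
      (∀ x ∈ T.Ktilde t, cut f A b y q x ≤ -(cost f A b Q (T.xhat t)).toReal + 1) → ‖q‖ ≤ M := by
  obtain ⟨M, hM⟩ := exists_norm_le_of_cut_le h.smooth h.Q_eq h.Q₁_bdd h.Kinit_compact h.qualif
    ((T.hbar 0).toReal + 1)
  refine ⟨M, fun t => hM (T.w (t + 1)) _ (h.μ₂_mem _) fun k hk => ?_, fun t y q hq hcut =>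
    hM y q hq fun k hk => ?_⟩
  · have h1 := h.cut_next_le t (h.Kinit_subset_KBefore (t + 1) hk)
    have h2 : (T.hbar t).toReal ≤ (T.hbar 0).toReal := h.hbar_toReal_antitone (Nat.zero_le t)
    have h3 := mul_nonneg (sub_nonneg.2 h.lam_mem.2.le) (h.gap_nonneg t)
    linarith
  · have h1 := hcut k (subset_cconv _ (Or.inl (h.Kinit_subset_KBefore t hk)))
    have h2 : (T.hbar t).toReal ≤ (T.hbar 0).toReal := h.hbar_toReal_antitone (Nat.zero_le t)
    have h3 := h.gap_nonneg t
    unfold Trace.gap at h3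
    linarith

/-- The dual point moves by an amount proportional to the gap when the last cut is kept. -/
theorem gap_sq_le_diverg (h : BoundedRun f β A b Q Q₁ Q₂ K Kinit lam T R) {t : ℕ}
    (hv : -T.v t ∈ T.Kcut t) :
    ((1 - lam) * T.gap f A b Q t) ^ 2 ≤
      (8 * β * (2 * R) ^ 2 + 4 * (‖b‖ + ‖A‖ * R) ^ 2) *
        diverg f (T.w t) (T.μ t).snd (T.w (t + 1)) (T.μ (t + 1)).snd := by
  have h1 := h.cut_next_le t hv
  have h2 : (T.hbar t).toReal ≤ cut f A b (T.w t) (T.μ t).snd (-T.v t) := by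
    rw [← EReal.coe_le_coe_iff, h.hbar_coe, h.hbar_eq_min]
    exact min_le_right _ _
  have hR : 0 ≤ R := (norm_nonneg _).trans h.w_norm
  set d₁ := gradient f (T.w t) - gradient f (T.w (t + 1)) with hd₁
  set d₂ := (T.μ t).snd - (T.μ (t + 1)).snd with hd₂
  have hg := h.smooth.gradient_le (T.w (t + 1)) (T.w t)
  -- The cut at `-v` falls by at least `(1 - λ)Δ`; convexity of `f^*`, in the form `hg`, makes this
  -- fall at most linear in the move.
  have key : (1 - lam) * T.gap f A b Q t ≤ ⟪d₁, T.w t + T.v t⟫_ℝ + ⟪d₂, b + A (T.v t)⟫_ℝ := by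
    simp only [cut, map_neg, inner_neg_right] at h1 h2
    simp only [hd₁, hd₂, inner_sub_left, inner_add_right, inner_sub_right] at hg ⊢
    linarith
  have k1 : ⟪d₁, T.w t + T.v t⟫_ℝ ≤ ‖d₁‖ * (2 * R) := by
    refine (real_inner_le_norm _ _).trans (mul_le_mul_of_nonneg_left ?_ (norm_nonneg _))
    have := norm_add_le (T.w t) (T.v t)
    linarith [h.norm_w_le t, h.v_norm t]
  have k2 : ⟪d₂, b + A (T.v t)⟫_ℝ ≤ ‖d₂‖ * (‖b‖ + ‖A‖ * R) := by
    refine (real_inner_le_norm _ _).trans (mul_le_mul_of_nonneg_left ?_ (norm_nonneg _))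
    refine (norm_add_le _ _).trans (add_le_add le_rfl ?_)
    exact (A.le_opNorm _).trans (mul_le_mul_of_nonneg_left (h.v_norm t) (norm_nonneg _))
  set r₁ := 2 * R
  set r₂ := ‖b‖ + ‖A‖ * R
  have hgap : 0 ≤ (1 - lam) * T.gap f A b Q t :=
    mul_nonneg (sub_nonneg.2 h.lam_mem.2.le) (h.gap_nonneg t)
  have hsq : ((1 - lam) * T.gap f A b Q t) ^ 2 ≤ 2 * (‖d₁‖ * r₁) ^ 2 + 2 * (‖d₂‖ * r₂) ^ 2 := by
    have := pow_le_pow_left₀ hgap (key.trans (add_le_add k1 k2)) 2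
    nlinarith [sq_nonneg (‖d₁‖ * r₁ - ‖d₂‖ * r₂)]
  have hb1 := h.smooth.norm_gradient_sub_sq_le h.β_pos (T.w t) (T.w (t + 1))
  have hb0 := h.smooth.bregman_nonneg (T.w t) (T.w (t + 1))
  rw [← hd₁] at hb1
  have hd : ‖(T.μ (t + 1)).snd - (T.μ t).snd‖ = ‖d₂‖ := norm_sub_rev _ _
  rw [diverg, hd]
  set D := bregman f (T.w t) (T.w (t + 1))
  have m1 : ‖d₁‖ ^ 2 * r₁ ^ 2 ≤ 4 * β * D * r₁ ^ 2 :=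
    mul_le_mul_of_nonneg_right hb1 (sq_nonneg _)
  have m2 : 0 ≤ r₂ ^ 2 * D := by positivity
  have m3 : 0 ≤ (β : ℝ) * r₁ ^ 2 * ‖d₂‖ ^ 2 := by positivity
  linarith

/-- The length of a phase without pruning is controlled by the gap at its beginning. -/
theorem exists_phase_bound (h : BoundedRun f β A b Q Q₁ Q₂ K Kinit lam T R) :
    ∃ B : ℝ, ∀ t m : ℕ,
      (∀ j < m, ¬ T.gap f A b Q (t + j + 1) < (1 - lam) * T.gapRef (t + j)) →
      m * T.gapRef t ^ 2 ≤ B := by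
  obtain ⟨M, hM1, hM2⟩ := h.exists_norm_μ₂_le
  have hlam : 0 < 1 - lam := sub_pos.2 h.lam_mem.2
  set c : ℝ := 8 * β * (2 * R) ^ 2 + 4 * (‖b‖ + ‖A‖ * R) ^ 2 with hc
  have hc0 : 0 ≤ c := by positivity
  set B₀ : ℝ := β * (2 * R) ^ 2 + (2 * M) ^ 2 / 2 with hB₀
  have hB₀0 : 0 ≤ B₀ := by positivity
  refine ⟨c * B₀ / (1 - lam) ^ 4, fun t m hm => ?_⟩
  rcases Nat.eq_zero_or_pos m with rfl | hmpos
  · simp only [Nat.cast_zero, zero_mul]; positivity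
  have hgb : ∀ j ≤ m, T.gapRef (t + j) = T.gapRef t := by
    intro j hj
    induction j with
    | zero => rfl
    | succ j ih =>
      rw [← add_assoc, h.gapRef_of_not_prune (hm j (by omega)), ih (by omega)]
  have hlast : (1 - lam) * T.gapRef t ≤ T.gap f A b Q (t + m) := by
    have := hm (m - 1) (by omega)
    rw [hgb _ (by omega), not_lt] at this
    rwa [show t + (m - 1) + 1 = t + m by omega] at this
  have href : 0 ≤ T.gapRef t := (h.gap_nonneg t).trans (h.gap_le_gapRef t)
  have hsub : ∀ i j : ℕ, j + i = m → T.Kcut (t + j) ⊆ T.Kcut (t + m) := by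
    intro i
    induction i with
    | zero => rintro j rfl; exact subset_rfl
    | succ i ih =>
      intro j hj
      refine subset_trans ?_ (ih (j + 1) (by omega))
      rw [← add_assoc, h.Kcut_of_not_prune (hm j (by omega))]
      exact subset_union_left
  -- The moves start from iterate `t + 1`: the bound `M` covers only iterates produced by a
  -- projection, and only iterations after `t` are known to keep their newest cut.
  set d : ℕ → ℝ := fun j => diverg f (T.w (t + j + 1)) (T.μ (t + j + 1)).snd
    (T.w (t + j + 2)) (T.μ (t + j + 2)).snd with hd
  have hsum : ∑ j ∈ Finset.range m, d j ≤ B₀ := by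
    set s := ∑ j ∈ Finset.range m, mass (T.n (t + j + 1)) with hs
    have hs0 : 0 ≤ s := Finset.sum_nonneg fun _ _ => mass_nonneg _
    refine le_of_forall_pos_le_add fun ε hε => ?_
    -- The total error is `δ` times the total mass `s`, fixed beforehand; `δ ≤ 1` keeps the
    -- comparison point within the bound `M`.
    set δ := min 1 (ε / (s + 1)) with hδ
    have hδ0 : 0 < δ := lt_min one_pos (by positivity)
    obtain ⟨q, hq, y, hy, hcut⟩ := h.exists_approx_dual (t + m) hδ0
    have hq' := hM2 (t + m) y q hq fun x hx => (hcut x hx).trans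
      (add_le_add le_rfl (min_le_left _ _))
    have hyR : ‖y‖ ≤ R := by simpa using (h.Ktilde_subset _ hy).2
    have tel : ∀ i ≤ m, diverg f (T.w (t + i + 1)) (T.μ (t + i + 1)).snd y q
        + ∑ j ∈ Finset.range i, d j ≤ diverg f (T.w (t + 1)) (T.μ (t + 1)).snd y q
          + δ * ∑ j ∈ Finset.range i, mass (T.n (t + j + 1)) := by
      intro i hi
      induction i with
      | zero => simp
      | succ i ih =>
        have ih' := ih (by omega)
        have hgi : T.gap f A b Q (t + i + 1) ≤ T.gapRef t := by
          rw [← hgb (i + 1) hi]; exact h.gap_le_gapRef _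
        have hhb : (T.hbar (t + m)).toReal ≤ (T.hbar (t + i + 1)).toReal :=
          h.hbar_toReal_antitone (by omega)
        -- `h̄` decreases, and `(1 - λ)` times the current gap is at most the final gap, so the
        -- level stays above the final lower bound.
        have hlev : -(cost f A b Q (T.xhat (t + m))).toReal ≤
            (T.hbar (t + i + 1)).toReal - (1 - lam) * T.gap f A b Q (t + i + 1) := by
          have := mul_le_mul_of_nonneg_left hgi hlam.le
          unfold Trace.gap at hlast this ⊢
          linarith
        have step := diverg_add_diverg_le h.smooth h.Q_convex (h.isCompact_KBefore (t + i + 2))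
          (h.n_sol (t + i + 1)) (h.run.w_next (t + i + 1)) (h.run.μ₂_next (t + i + 1)) hq
          (y := y) (ε := δ) (fun k hk => (hcut k (h.Kcut_subset_Ktilde _
            (hsub (m - (i + 1)) (i + 1) (by omega) hk))).trans (add_le_add hlev le_rfl))
        rw [Finset.sum_range_succ, Finset.sum_range_succ]
        simp only [hd]
        simp only [hd] at ih'
        rw [show t + (i + 1) + 1 = t + i + 2 by ring]
        rw [show t + i + 1 + 1 = t + i + 2 by ring] at step
        linarith
    have hend := tel m le_rfl
    have hnn : 0 ≤ diverg f (T.w (t + m + 1)) (T.μ (t + m + 1)).snd y q :=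
      add_nonneg (h.smooth.bregman_nonneg _ _) (by positivity)
    have hstart : diverg f (T.w (t + 1)) (T.μ (t + 1)).snd y q ≤ B₀ := by
      refine add_le_add ((h.smooth.bregman_le _ _).trans ?_) ?_
      · refine mul_le_mul_of_nonneg_left (pow_le_pow_left₀ (norm_nonneg _) ?_ 2) β.coe_nonneg
        have := norm_sub_le (T.w (t + 1)) y
        linarith [h.norm_w_le (t + 1)]
      · refine div_le_div_of_nonneg_right (pow_le_pow_left₀ (norm_nonneg _) ?_ 2) two_pos.le
        have := norm_sub_le q (T.μ (t + 1)).snd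
        linarith [hM1 t]
    have hδs : δ * s ≤ ε := by
      have : δ * (s + 1) ≤ ε := by
        rw [← le_div_iff₀ (by positivity)]; exact min_le_right _ _
      linarith
    linarith
  -- One factor `1 - λ` comes from the level, the other from comparing the gap with the reference
  -- gap.
  have hterm : ∀ j ∈ Finset.range m, ((1 - lam) ^ 2 * T.gapRef t) ^ 2 ≤ c * d j := by
    intro j hj
    rw [Finset.mem_range] at hj
    have hv : -T.v (t + j + 1) ∈ T.Kcut (t + j + 1) := by
      rw [h.Kcut_of_not_prune (hm j hj)]
      exact Or.inr rfl
    refine le_trans (pow_le_pow_left₀ (by positivity) ?_ 2) (h.gap_sq_le_diverg hv)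
    have h1 : T.gap f A b Q (t + m) ≤ T.gap f A b Q (t + j + 1) := h.gap_antitone (by omega)
    have := mul_le_mul_of_nonneg_left (hlast.trans h1) hlam.le
    linarith
  have htot := Finset.sum_le_sum hterm
  rw [← Finset.mul_sum, Finset.sum_const, Finset.card_range, nsmul_eq_mul] at htot
  have := htot.trans (mul_le_mul_of_nonneg_left hsum hc0)
  rw [le_div_iff₀ (by positivity)]
  linarith

theorem exists_rate (h : BoundedRun f β A b Q Q₁ Q₂ K Kinit lam T R) :
    ∃ C : ℝ, 0 < C ∧ ∀ t : ℕ, 1 ≤ t → T.gap f A b Q t ≤ C / Real.sqrt t := by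
  obtain ⟨B, hB⟩ := h.exists_phase_bound
  have hlam := h.lam_mem
  obtain ⟨C, hC, hCt⟩ := exists_mul_gap_sq_le (gap := T.gap f A b Q) (ref := T.gapRef)
    (a := 1 - lam) (sub_pos.2 hlam.2) (by linarith [hlam.1]) h.gap_nonneg
    h.gap_antitone h.gap_le_gapRef (fun _ => h.gapRef_of_prune) (fun _ => h.gapRef_of_not_prune) hB
  refine ⟨Real.sqrt C, Real.sqrt_pos.2 hC, fun t ht => ?_⟩
  have ht0 : (0 : ℝ) < t := by exact_mod_cast ht
  rw [← Real.sqrt_div hC.le]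
  refine Real.le_sqrt_of_sq_le ?_
  rw [le_div_iff₀ ht0, mul_comm]
  exact hCt t

end BoundedRun

end DLS

end

theorem mainTheorem4
    {E₁ E₂ : Type*}
    [NormedAddCommGroup E₁] [InnerProductSpace ℝ E₁] [CompleteSpace E₁]
    [MeasurableSpace E₁] [BorelSpace E₁]
    [NormedAddCommGroup E₂] [InnerProductSpace ℝ E₂] [CompleteSpace E₂]
    -- `f` is convex with `β`-Lipschitz gradient
    (f : E₁ → ℝ) (β : ℝ≥0) (hβ : 0 < β) (hf_convex : ConvexOn ℝ Set.univ f)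
    (hf_diff : Differentiable ℝ f) (hf_lip : LipschitzWith β (gradient f))
    -- `Q` is the sum of a bounded closed convex set and a closed convex cone
    (Q Q₁ Q₂ : Set E₂) (hQ : Q = Q₁ + Q₂) (hQ_ne : Q.Nonempty)
    (hQ₁_closed : IsClosed Q₁) (hQ₁_convex : Convex ℝ Q₁) (hQ₁_bdd : Bornology.IsBounded Q₁)
    (hQ₂_closed : IsClosed Q₂) (hQ₂_convex : Convex ℝ Q₂)
    (hQ₂_cone : ∀ c : ℝ, 0 < c → ∀ x ∈ Q₂, c • x ∈ Q₂)
    (K : Set E₁) (hK_ne : K.Nonempty) (hK_closed : IsClosed K) (hK_convex : Convex ℝ K)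
    (A : E₁ →L[ℝ] E₂) (b : E₂)
    -- qualification condition
    (Kinit : Set E₁) (hKinit_compact : IsCompact Kinit) (hKinit_sub : Kinit ⊆ K)
    (hqualif : -b ∈ interior (DLS.polar Q₂ - A '' DLS.cconv Kinit))
    -- an execution of the algorithm with bounded oracle outputs
    (lam : ℝ) (hlam : lam ∈ Set.Ioo (0 : ℝ) 1)
    (T : DLS.Trace E₁ E₂) (hT : DLS.IsRun f A b Q K Kinit lam T)
    (horacle : ∃ C : ℝ, ∀ t, ‖T.v t‖ ≤ C) :
    -- `Δ^t` is the primal-dual gap at `(x̂^t, μ̂^t)`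
    (∀ t, T.Δ f A b Q t =
      (DLS.cost f A b Q (T.xhat t) + DLS.indic K (T.xhat t)) + DLS.dualCost f A b Q K (T.μhat t)) ∧
    -- the solution `x̂^t` of the lifted primal update with first component `x̂₁^t` exists and
    -- satisfies `x̂₂^t = A x̂₁^t`
    (∀ (t : ℕ) (x : WithLp 2 (E₁ × E₂)),
      (DLS.IsSolution (DLS.liftedCost f b Q) (-T.Etilde A t) x ∧ x.fst = T.xhat t) ↔
        (x.fst = T.xhat t ∧ x.snd = A (T.xhat t))) ∧
    -- convergence rates
    ∃ C : ℝ, 0 < C ∧ ∀ t : ℕ, 1 ≤ t →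
      (0 ≤ T.Δ f A b Q t ∧ T.Δ f A b Q t ≤ ((C / Real.sqrt t : ℝ) : EReal)) ∧
      (0 ≤ DLS.cost f A b Q (T.xhat t) - DLS.value f A b Q K ∧
        DLS.cost f A b Q (T.xhat t) - DLS.value f A b Q K ≤ ((C / Real.sqrt t : ℝ) : EReal)) ∧
      (0 ≤ DLS.dualCost f A b Q K (T.μhat t) + DLS.value f A b Q K ∧
        DLS.dualCost f A b Q K (T.μhat t) + DLS.value f A b Q K
          ≤ ((C / Real.sqrt t : ℝ) : EReal)) := by
  have hKinit_bdd := hKinit_compact.isBounded.exists_norm_le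
  obtain ⟨R₁, hR₁⟩ := hKinit_bdd
  obtain ⟨R₂, hR₂⟩ := horacle
  have h : DLS.BoundedRun f β A b Q Q₁ Q₂ K Kinit lam T (max R₁ (max R₂ ‖T.w 0‖)) :=
    { smooth := ⟨hf_convex, hf_diff, hf_lip⟩
      β_pos := hβ
      Q_eq := hQ
      Q_ne := hQ_ne
      Q_convex := hQ ▸ hQ₁_convex.add hQ₂_convex
      Q₁_bdd := hQ₁_bdd
      K_closed := hK_closed
      K_convex := hK_convex
      Kinit_compact := hKinit_compact
      Kinit_sub := hKinit_sub
      qualif := hqualif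
      lam_mem := hlam
      run := hT
      Kinit_norm := fun k hk => (hR₁ k hk).trans (le_max_left _ _)
      v_norm := fun t => (hR₂ t).trans ((le_max_left _ _).trans (le_max_right _ _))
      w_norm := (le_max_right _ _).trans (le_max_right _ _) }
  obtain ⟨V, hV, hVt⟩ := h.exists_value_eq
  obtain ⟨C, hC, hrate⟩ := h.exists_rate
  refine ⟨h.gap_eq_cost_add_dualCost, h.lifted_solution_iff, C, hC, fun t ht => ?_⟩
  have hgap := hrate t ht
  have hVt' := hVt t
  rw [h.Δ_eq_gap, h.dualCost_μhat, hV, ← h.cost_xhat, ← h.hbar_coe, ← EReal.coe_sub,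
    ← EReal.coe_add, ← EReal.coe_zero]
  simp only [EReal.coe_le_coe_iff]
  have hnn := h.gap_nonneg t
  unfold DLS.Trace.gap at hgap hnn ⊢
  refine ⟨⟨hnn, hgap⟩, ⟨?_, ?_⟩, ?_, ?_⟩ <;> linarith
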